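/- **Theorem (Character classification of Glaisher divisors).** Let $\mathcal F$ be a set of positive integers defined by a finite Boolean combination (conjunctions, disjunctions, negations) of congruence conditions $d\equiv a\pmod m$ with $m\ge 1$, $\gcd(a,m)=1$, and coprimality conditions $\gcd(d,r)=1$ with $r\ge1$ (for $r=p$ prime: exclusion of the multiples of $p$). Let $L$ be the least common multiple of all the moduli $m$ and $r$ that occur. For integers $s\ge0$, $n\ge 0$ put $$\sigma^{(s)}_{\mathcal F}(n)=\sum_{d\mid n,\ d\in\mathcal F}d^s,\qquad \widehat M_s(n)=\sum_{k\ge1,\ k\in\mathcal F}k^s F_k(n),$$ where $F_k(n)$ is the total number of parts of size $k$ in all partitions of $n$ (and $\sigma^{(s)}_{\mathcal F}(0)=0$). For a Dirichlet character $\chi$ modulo $N$ put $\sigma_s(n;\chi)=\sum_{d\mid n}\chi(d)d^s$ for $n\ge1$, and for $\operatorname{Im}\tau>0$, $q=e^{2\pi i\tau}$, $$E_{s+1}(\tau,\chi)=-\frac{B_{s+1,\chi}}{2(s+1)}+\sum_{n\ge1}\sigma_s(n;\chi)q^n,\qquad B_{k,\chi}=N^{k-1}\sum_{a=1}^{N}\chi(a)B_k(a/N),$$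 where $B_k(x)$ is the $k$-th Bernoulli polynomial. Let $\eta(\tau)=q^{1/24}\prod_{n\ge1}(1-q^n)$, with $q^{1/24}=e^{2\pi i\tau/24}$. Then there are a finite set $T$ of Dirichlet characters $\chi$ modulo integers $N_\chi$ dividing $L$ and coefficients $c_\chi\in\mathbb Q(\chi)$ (the field generated over $\mathbb Q$ by the values of $\chi$; so $c_\chi\in\mathbb Q$ if $\chi$ is real-valued), depending only on $\mathcal F$, such that for every integer $s\ge0$: 1. $\displaystyle\sigma^{(s)}_{\mathcal F}(n)=\sum_{\chi\in T}c_\chi\,\sigma_s(n;\chi)$ for all $n\ge1$. 2. For all $\tau$ in the upper half-plane the following series converge absolutely and $$q^{-1/24}\sum_{n\ge0}\widehat M_s(n)q^n=\eta(\tau)^{-1}\sum_{n\ge1}\sigma^{(s)}_{\mathcal F}(n)q^n=\eta(\tau)^{-1}\sum_{\chi\in T}c_\chi\Bigl(E_{s+1}(\tau,\chi)+\frac{B_{s+1,\chi}}{2(s+1)}\Bigr),$$ that is, up to the explicit constant $\sum_\chi c_\chi B_{s+1,\chi}/(2(s+1))$, the filtered moment series is $\eta^{-1}$ times a finite linear combination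 of twisted Eisenstein series. 3. For every $\chi\in T$ of matching parity $\chi(-1)=(-1)^{s+1}$, except when $s=1$ and $N_\chi=1$ (where $E_2(\tau,\mathbf 1)$ is only quasimodular), the function $E_{s+1}(\tau,\chi)$ is a modular form (holomorphic also at all cusps) of weight $s+1$ on $\Gamma_0(N_\chi)$ with Nebentypus $\chi$. -/

import Mathlib

open scoped UpperHalfPlane MatrixGroups

noncomputable section

/-- A Glaisher divisor filter: a condition on positive integers built by finitely many
conjunctions, disjunctions and negations from reduced congruence conditions
`d ≡ a (mod m)`, `gcd (a, m) = 1`, and coprimality conditions `gcd (d, r) = 1`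
(for `r = p` prime: exclusion of the multiples of `p`). -/
inductive GlaisherFilter : Type
  | residue (m a : ℕ) (hm : 0 < m) (ha : Nat.Coprime a m) : GlaisherFilter
  | coprime (r : ℕ) (hr : 0 < r) : GlaisherFilter
  | not (F : GlaisherFilter) : GlaisherFilter
  | and (F G : GlaisherFilter) : GlaisherFilter
  | or (F G : GlaisherFilter) : GlaisherFilter

namespace GlaisherFilter

/-- The integer `d` is selected by the filter. -/
def Holds : GlaisherFilter → ℕ → Prop
  | residue m a _ _, d => d ≡ a [MOD m]
  | coprime r _, d => Nat.Coprime d r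
  | not F, d => ¬ F.Holds d
  | and F G, d => F.Holds d ∧ G.Holds d
  | or F G, d => F.Holds d ∨ G.Holds d

/-- The level of a filter: the least common multiple of all moduli occurring in it. -/
def level : GlaisherFilter → ℕ
  | residue m _ _ _ => m
  | coprime r _ => r
  | not F => F.level
  | and F G => Nat.lcm F.level G.level
  | or F G => Nat.lcm F.level G.level

open Classical in
/-- The filtered divisor sum `∑ d ^ s` over the divisors `d` of `n` selected by `F`. -/
def divisorSum (F : GlaisherFilter) (s n : ℕ) : ℕ :=
  ∑ d ∈ n.divisors with F.Holds d, d ^ s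

end GlaisherFilter

/-- `F_k(n)`: the total number of parts of size `k` in all partitions of `n`. -/
def partFrequency (k n : ℕ) : ℕ :=
  ∑ p : n.Partition, p.parts.count k

open Classical in
/-- The filtered frequency moment `∑ k ^ s * F_k(n)` over the part sizes `k ≥ 1` selected by the
filter (part sizes exceeding `n` do not occur in partitions of `n`). -/
def GlaisherFilter.frequencyMoment (F : GlaisherFilter) (s n : ℕ) : ℕ :=
  ∑ k ∈ Finset.Icc 1 n with F.Holds k, k ^ s * partFrequency k n

/-- The twisted divisor sum `σ_s(n; χ) = ∑ χ(d) d ^ s` over the divisors `d` of `n`. -/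
def twistedSigma (s : ℕ) {N : ℕ} (χ : DirichletCharacter ℂ N) (n : ℕ) : ℂ :=
  ∑ d ∈ n.divisors, χ (d : ZMod N) * (d : ℂ) ^ s

/-- The generalized Bernoulli number
`B_{k, χ} = N ^ (k - 1) * ∑_{a = 1}^{N} χ(a) B_k(a / N)`, where `B_k(x)` is the `k`-th Bernoulli
polynomial. -/
def generalizedBernoulli (k : ℕ) {N : ℕ} (χ : DirichletCharacter ℂ N) : ℂ :=
  (N : ℂ) ^ ((k : ℤ) - 1) *
    ∑ a ∈ Finset.Icc 1 N,
      χ (a : ZMod N) * (((Polynomial.bernoulli k).eval ((a : ℚ) / (N : ℚ)) : ℚ) : ℂ)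

/-- The constant term `- B_{s+1, χ} / (2 (s + 1))` of the Eisenstein series `E_{s+1}(τ, χ)`. -/
def twistedEisensteinConst (s : ℕ) {N : ℕ} (χ : DirichletCharacter ℂ N) : ℂ :=
  -generalizedBernoulli (s + 1) χ / (2 * ((s : ℂ) + 1))

/-- The twisted Eisenstein series of weight `s + 1`,
`E_{s+1}(τ, χ) = - B_{s+1, χ} / (2 (s + 1)) + ∑_{n ≥ 1} σ_s(n; χ) q ^ n`, `q = e ^ (2 π i τ)`
(the term `n = 0` of the series below is zero). -/
def twistedEisenstein (s : ℕ) {N : ℕ} (χ : DirichletCharacter ℂ N) (τ : ℍ) : ℂ :=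
  twistedEisensteinConst s χ +
    ∑' n : ℕ, twistedSigma s χ n * Function.Periodic.qParam 1 (τ : ℂ) ^ n

/-- `f` is a holomorphic modular form (holomorphic on the upper half-plane and at all cusps) of
weight `k` on `Γ₀(N)` with Nebentypus `χ`. -/
def IsModularFormNebentypus (N : ℕ) (k : ℤ) (χ : DirichletCharacter ℂ N) (f : ℍ → ℂ) : Prop :=
  (∃ g : ModularForm ((CongruenceSubgroup.Gamma1 N).map (Matrix.SpecialLinearGroup.mapGL ℝ)) k,
    ⇑g = f) ∧
  ∀ γ : SL(2, ℤ), γ ∈ CongruenceSubgroup.Gamma0 N → ∀ τ : ℍ,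
    f (γ • τ) =
      χ ((γ 1 1 : ℤ) : ZMod N) * (((γ 1 0 : ℤ) : ℂ) * (τ : ℂ) + ((γ 1 1 : ℤ) : ℂ)) ^ k * f τ

end

/-! Removing parts of size k one at a time gives F_k(n) = ∑_{j ≥ 1} p(n - jk). Weighting by k^s and
summing over the selected k makes the moment series the Cauchy product of the filtered divisor
series and the partition generating function (`hasSum_frequencyMoment`); Euler's product identifies
the latter with q^(1/24)/η.

The indicator of a filter is a polynomial in indicators of reduced residue classes and of
coprimality conditions. By the Chinese remainder theorem it is a rational combination of indicators
of "gcd(d, r) = 1 and d ≡ a (mod m)", and orthogonality of the characters mod m, inflated to modulus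
lcm(m, r), expands each of these (`exists_characterCombination`). Claims 1 and 2 then follow by
linearity.

Modularity is obtained for all weights at once from a generating function in an elliptic variable z.
The logarithmic derivative `quasiZeta` of the theta function is quasi-periodic with simple poles on
the lattice, so Liouville's theorem yields its transformation under SL(2, ℤ) (`quasiZeta_div`).
Weighting its translates by the points b/N with the finite Fourier coefficients of χ gives a
function transforming under Γ₀(N) through χ (`twistedZeta_div`). In t = 2πiz, up to the factor -2πi
and a polar term, this function is `twistedGen`, whose s-th derivative at 0 is 2 E_{s+1}(τ, χ) when
the parities match: the constants come from the Bernoulli generating function, the rest from Lambert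
series. Comparing Taylor coefficients gives the transformation law, with no special treatment of
weights 1 and 2 and no primitivity assumption. The only anomaly is linear in z and proportional to
χ(0), so it matters only for s = 1, N = 1.

At the cusps, polynomial growth on vertical strips and periodicity make the singularity at q = 0
removable. -/

/-! ### Partition numbers and Euler's product. -/

namespace Nat.Partition

/-- The number of partitions of `n` all of whose parts are at most `N`. -/
def boundedCount (N n : ℕ) : ℕ := (restricted n (· ≤ N)).card

theorem boundedCount_zero_left (n : ℕ) : boundedCount 0 n = if n = 0 then 1 else 0 := by
  split_ifs with h
  · subst h
    simp [boundedCount, restricted]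
  · rw [boundedCount, Finset.card_eq_zero, Finset.eq_empty_iff_forall_notMem]
    intro p hp
    simp only [restricted, Finset.mem_filter, Finset.mem_univ, true_and] at hp
    have : p.parts = 0 := Multiset.eq_zero_of_forall_notMem fun a ha => by
      have := hp a ha
      have := p.parts_pos ha
      omega
    have h2 := p.parts_sum
    simp [this] at h2
    exact h h2.symm

theorem boundedCount_eq_card {N n : ℕ} (h : n ≤ N) :
    boundedCount N n = Fintype.card n.Partition := by
  rw [boundedCount, restricted, Finset.filter_true_of_mem, Finset.card_univ]
  intro p _ a ha
  exact (le_of_mem_parts ha).trans h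

theorem boundedCount_le_card (N n : ℕ) : boundedCount N n ≤ Fintype.card n.Partition :=
  Finset.card_le_univ _

/-- Split according to whether N + 1 occurs as a part; deleting one occurrence is a bijection onto
the partitions of n - (N + 1) with the same bound on parts. -/
theorem boundedCount_succ (N n : ℕ) :
    boundedCount (N + 1) n =
      boundedCount N n + if N + 1 ≤ n then boundedCount (N + 1) (n - (N + 1)) else 0 := by
  have hsplit := Finset.card_filter_add_card_filter_not (s := restricted n (· ≤ N + 1))
    (fun p : n.Partition => N + 1 ∈ p.parts)
  have h1 : ((restricted n (· ≤ N + 1)).filter (fun p => ¬ N + 1 ∈ p.parts)) =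
      restricted n (· ≤ N) := by
    ext p
    simp only [restricted, Finset.mem_filter, Finset.mem_univ, true_and]
    constructor
    · rintro ⟨h, h'⟩ i hi
      have := h i hi
      have : i ≠ N + 1 := fun e => h' (e ▸ hi)
      omega
    · intro h
      exact ⟨fun i hi => (h i hi).trans (by omega), fun h' => by have := h _ h'; omega⟩
  have h2 : ((restricted n (· ≤ N + 1)).filter (fun p => N + 1 ∈ p.parts)).card =
      if N + 1 ≤ n then boundedCount (N + 1) (n - (N + 1)) else 0 := by
    split_ifs with h
    · symm
      refine Finset.card_bij
        (fun q _ => ((partitionWithPartEquiv (Nat.succ_pos N) h).symm q).1) ?_ ?_ ?_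
      · intro q hq
        simp only [restricted, Finset.mem_filter, Finset.mem_univ, true_and] at hq ⊢
        simpa using fun a ha => hq a ha
      · intro q _ q' _ hqq
        exact (partitionWithPartEquiv (Nat.succ_pos N) h).symm.injective (Subtype.ext hqq)
      · intro p hp
        simp only [restricted, Finset.mem_filter, Finset.mem_univ, true_and] at hp
        refine ⟨partitionWithPartEquiv (Nat.succ_pos N) h ⟨p, hp.2⟩, ?_, by simp⟩
        simp only [restricted, Finset.mem_filter, Finset.mem_univ, true_and,
          partitionWithPartEquiv_apply_parts]
        exact fun i hi => hp.1 i (Multiset.mem_of_mem_erase hi)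
    · rw [Finset.card_eq_zero, Finset.eq_empty_iff_forall_notMem]
      intro p hp
      exact h (le_of_mem_parts (Finset.mem_filter.mp hp).2)
  rw [h1, h2] at hsplit
  rw [boundedCount, ← hsplit, add_comm]
  rfl

/-- A crude bound, needed only to have convergence for |q| < 1 before the generating function is
computed. -/
theorem boundedCount_le_pow (N n : ℕ) : boundedCount N n ≤ (n + 1) ^ N := by
  induction N generalizing n with
  | zero => rw [boundedCount_zero_left]; split_ifs <;> simp
  | succ N ih =>
    induction n using Nat.strong_induction_on with
    | _ n ihn =>
      rw [boundedCount_succ]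
      split_ifs with h
      · have h1 := ihn (n - (N + 1)) (by omega)
        have h2 : (n - (N + 1) + 1) ^ (N + 1) ≤ n ^ (N + 1) :=
          Nat.pow_le_pow_left (by omega) _
        have h3 : n ^ (N + 1) ≤ (n + 1) ^ N * n := by
          rw [pow_succ]
          exact Nat.mul_le_mul_right _ (Nat.pow_le_pow_left (by omega) _)
        calc _ ≤ (n + 1) ^ N + (n + 1) ^ N * n := Nat.add_le_add (ih n) (h1.trans (h2.trans h3))
          _ = (n + 1) ^ (N + 1) := by ring
      · simpa using (ih n).trans (Nat.pow_le_pow_right (by omega) (by omega))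

theorem summable_norm_boundedCount (N : ℕ) {q : ℂ} (hq : ‖q‖ < 1) :
    Summable fun n : ℕ => ‖(boundedCount N n : ℂ) * q ^ n‖ := by
  have h := summable_norm_pow_mul_geometric_of_norm_lt_one N hq
  have h2 := (summable_nat_add_iff 1).mpr h
  rcases eq_or_ne q 0 with rfl | hq0
  · exact summable_of_ne_finset_zero (s := {0}) fun b hb => by
      simp at hb; simp [hb]
  refine Summable.of_nonneg_of_le (fun _ => norm_nonneg _) (fun n => ?_)
    (h2.mul_left ‖q‖⁻¹)
  have hq' : ‖q‖ ≠ 0 := by simpa using hq0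
  simp only [norm_mul, norm_pow, RCLike.norm_natCast]
  have : ‖q‖⁻¹ * (((n + 1 : ℕ) : ℝ) ^ N * ‖q‖ ^ (n + 1)) = ((n + 1 : ℕ) : ℝ) ^ N * ‖q‖ ^ n := by
    rw [pow_succ]
    field_simp
  rw [this]
  gcongr
  exact_mod_cast boundedCount_le_pow N n

/-- The recursion reads B_{N+1} = B_N + q^(N+1) B_{N+1} for the generating functions; convergence
being known, it can be solved for B_{N+1}. -/
theorem hasSum_boundedCount (N : ℕ) {q : ℂ} (hq : ‖q‖ < 1) :
    HasSum (fun n : ℕ => (boundedCount N n : ℂ) * q ^ n)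
      (∏ i ∈ Finset.range N, (1 - q ^ (i + 1)))⁻¹ := by
  induction N with
  | zero =>
    simp only [boundedCount_zero_left, Finset.range_zero, Finset.prod_empty, inv_one]
    convert hasSum_ite_eq (0 : ℕ) (1 : ℂ) using 2 with n
    split_ifs with h <;> simp [h]
  | succ N ih =>
    have hs := (summable_norm_boundedCount (N + 1) hq).of_norm
    have hne : (1 - q ^ (N + 1)) ≠ 0 := by
      intro h
      have : ‖q ^ (N + 1)‖ < 1 := by
        rw [norm_pow]; exact pow_lt_one₀ (norm_nonneg _) hq (by omega)
      rw [← sub_eq_zero.mp h] at this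
      simp at this
    have hshift : HasSum (fun n : ℕ => ((if N + 1 ≤ n then boundedCount (N + 1) (n - (N + 1))
        else 0 : ℕ) : ℂ) * q ^ n)
        (q ^ (N + 1) * ∑' n : ℕ, (boundedCount (N + 1) n : ℂ) * q ^ n) := by
      rw [← hasSum_nat_add_iff' (N + 1), Finset.sum_eq_zero, sub_zero]
      · refine (hs.hasSum.mul_left (q ^ (N + 1))).congr_fun fun n => ?_
        rw [if_pos (by omega), Nat.add_sub_cancel]
        ring
      · intro i hi
        rw [if_neg (by have := Finset.mem_range.mp hi; omega)]
        simp
    have h := (ih.add hshift).congr_fun (g := fun n : ℕ => (boundedCount (N + 1) n : ℂ) * q ^ n)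
      (fun n => by rw [boundedCount_succ N n]; push_cast; ring)
    have he := h.tsum_eq
    rw [Finset.prod_range_succ, mul_inv]
    have hval : (∏ i ∈ Finset.range N, (1 - q ^ (i + 1)))⁻¹ * (1 - q ^ (N + 1))⁻¹ =
        ∑' n : ℕ, (boundedCount (N + 1) n : ℂ) * q ^ n := by
      rw [mul_inv_eq_iff_eq_mul₀ hne, mul_sub, mul_one]
      linear_combination -he
    rw [hval]
    exact hs.hasSum

theorem boundedCount_eventually_eq (n : ℕ) :
    ∀ᶠ N in Filter.atTop, boundedCount N n = Fintype.card n.Partition :=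
  Filter.eventually_atTop.mpr ⟨n, fun _ h => boundedCount_eq_card h⟩

theorem tendsto_prod_one_sub_pow {q : ℂ} (hq : ‖q‖ < 1) :
    Filter.Tendsto (fun N => (∏ i ∈ Finset.range N, (1 - q ^ (i + 1)))⁻¹) Filter.atTop
      (nhds (∏' i : ℕ, (1 - q ^ (i + 1)))⁻¹) := by
  refine (ModularForm.multipliable_one_sub_pow hq).hasProd.tendsto_prod_nat.inv₀ ?_
  refine tprod_one_add_ne_zero_of_summable (f := fun n : ℕ ↦ -q ^ (n + 1)) (fun n => ?_) ?_
  · intro h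
    have h1 : ‖q ^ (n + 1)‖ < 1 := by
      rw [norm_pow]; exact pow_lt_one₀ (norm_nonneg _) hq (by omega)
    have h2 : q ^ (n + 1) = 1 := by linear_combination -h
    rw [h2] at h1
    simp at h1
  · simpa using (summable_nat_add_iff 1).mpr
      (summable_geometric_of_lt_one (norm_nonneg _) hq)

/-- The first M terms do not change when p(n) is replaced by the count with parts at most M, so the
partial sums are bounded by the finite products at |q|, which converge. -/
theorem summable_norm_card {q : ℂ} (hq : ‖q‖ < 1) :
    Summable fun n : ℕ => ‖(Fintype.card n.Partition : ℂ) * q ^ n‖ := by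
  have hr : ‖((‖q‖ : ℝ) : ℂ)‖ < 1 := by simpa using hq
  have ht := (tendsto_prod_one_sub_pow hr).norm
  obtain ⟨B, hB⟩ := ht.bddAbove_range
  refine summable_of_sum_range_le (c := B) (fun _ => norm_nonneg _) fun M => ?_
  have h1 : ∑ n ∈ Finset.range M, ‖(Fintype.card n.Partition : ℂ) * q ^ n‖ =
      ∑ n ∈ Finset.range M, ‖(boundedCount M n : ℂ) * ((‖q‖ : ℝ) : ℂ) ^ n‖ :=
    Finset.sum_congr rfl fun n hn => by
      rw [boundedCount_eq_card (Finset.mem_range.mp hn).le]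
      simp
  have hsum := hasSum_boundedCount M hr
  have h3 : (∑' n : ℕ, (boundedCount M n : ℂ) * ((‖q‖ : ℝ) : ℂ) ^ n) =
      ((∑' n : ℕ, ‖(boundedCount M n : ℂ) * ((‖q‖ : ℝ) : ℂ) ^ n‖ : ℝ) : ℂ) := by
    rw [Complex.ofReal_tsum]
    refine tsum_congr fun n => ?_
    simp
  rw [h1]
  refine ((summable_norm_boundedCount M hr).sum_le_tsum _ fun _ _ => norm_nonneg _).trans
    (le_trans ?_ (hB ⟨M, rfl⟩))
  simp only
  rw [← hsum.tsum_eq, h3, Complex.norm_real]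
  exact le_abs_self _

/-- Euler's product for the generating function of the partition numbers. -/
theorem tsum_card_mul_pow {q : ℂ} (hq : ‖q‖ < 1) :
    ∑' n : ℕ, (Fintype.card n.Partition : ℂ) * q ^ n = (∏' i : ℕ, (1 - q ^ (i + 1)))⁻¹ := by
  refine tendsto_nhds_unique ?_ (tendsto_prod_one_sub_pow hq)
  simp_rw [← (hasSum_boundedCount _ hq).tsum_eq]
  -- Each coefficient is eventually constant in N, and p(n) |q|^n dominates.
  refine tendsto_tsum_of_dominated_convergence (summable_norm_card hq) (fun n => ?_)
    (Filter.Eventually.of_forall fun N n => ?_)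
  · refine tendsto_const_nhds.congr' ?_
    filter_upwards [boundedCount_eventually_eq n] with N hN
    rw [hN]
  · simp only [norm_mul, norm_pow, RCLike.norm_natCast]
    gcongr
    exact_mod_cast boundedCount_le_card N n

end Nat.Partition

/-! ### Frequencies of part sizes and the convolution formula. -/

/-- Removing one part of size `k` gives a recursion for the number of parts of size `k`. -/
theorem partFrequency_recursion {k n : ℕ} (hk : 1 ≤ k) (hkn : k ≤ n) :
    partFrequency k n = Fintype.card (n - k).Partition + partFrequency k (n - k) := by
  have h1 : partFrequency k n =
      ∑ p ∈ Finset.univ.filter (fun p : n.Partition => k ∈ p.parts), p.parts.count k := by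
    rw [partFrequency, Finset.sum_filter_of_ne]
    intro p _ h
    exact Multiset.count_ne_zero.mp h
  rw [h1, Finset.sum_subtype (p := fun p : n.Partition => k ∈ p.parts) _ (by simp),
    ← (Nat.Partition.partitionWithPartEquiv hk hkn).symm.sum_comp]
  simp [partFrequency, Finset.sum_add_distrib, add_comm]

theorem partFrequency_eq_zero {k n : ℕ} (h : n < k) : partFrequency k n = 0 :=
  Finset.sum_eq_zero fun _ _ => Multiset.count_eq_zero.mpr fun hp =>
    (Nat.Partition.le_of_mem_parts hp).not_gt h

/-- Iterating the recursion gives ∑_{j ≥ 1} p(n - jk); writing jk as a nonzero multiple x.1 of k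
prepares the exchange of summations that produces divisor sums. -/
theorem partFrequency_eq_sum {k : ℕ} (hk : 1 ≤ k) (n : ℕ) :
    partFrequency k n =
      ∑ x ∈ Finset.HasAntidiagonal.antidiagonal n, if x.1 ≠ 0 ∧ k ∣ x.1 then Fintype.card x.2.Partition else 0 := by
  induction n using Nat.strong_induction_on with
  | _ n ih =>
    rw [Finset.Nat.sum_antidiagonal_eq_sum_range_succ_mk]
    rcases lt_or_ge n k with h | h
    · rw [partFrequency_eq_zero h, Finset.sum_eq_zero]
      intro i hi
      rw [if_neg]
      rintro ⟨h0, hd⟩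
      have := Nat.le_of_dvd (Nat.pos_of_ne_zero h0) hd
      have := Finset.mem_range.mp hi
      omega
    · rw [partFrequency_recursion hk h, ih (n - k) (by omega),
        Finset.Nat.sum_antidiagonal_eq_sum_range_succ_mk]
      have : n.succ = k + (n - k).succ := by omega
      rw [this, Finset.sum_range_add]
      have h0 : ∑ i ∈ Finset.range k, (if i ≠ 0 ∧ k ∣ i then
          Fintype.card (n - i).Partition else 0) = 0 := by
        refine Finset.sum_eq_zero fun i hi => if_neg ?_
        rintro ⟨h0, hd⟩
        have := Nat.le_of_dvd (Nat.pos_of_ne_zero h0) hd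
        have := Finset.mem_range.mp hi
        omega
      simp only [h0, zero_add]
      -- On the left the term i = 0 is p(n - k), the new summand of the recursion; on the right the
      -- term i = 0 vanishes because x.1 = 0 is excluded.
      rw [Finset.sum_range_succ', Finset.sum_range_succ']
      have e1 : (if k + 0 ≠ 0 ∧ k ∣ k + 0 then Fintype.card (n - (k + 0)).Partition else 0) =
          Fintype.card (n - k).Partition := by
        rw [if_pos ⟨by omega, by simp⟩, add_zero]
      rw [e1, if_neg (by simp), add_zero, add_comm]
      congr 1
      refine Finset.sum_congr rfl fun i _ => ?_
      have e2 : (k + (i + 1) ≠ 0 ∧ k ∣ k + (i + 1)) ↔ (i + 1 ≠ 0 ∧ k ∣ i + 1) := by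
        simp
      simp only [e2, Nat.sub_sub]

namespace GlaisherFilter

theorem frequencyMoment_eq_sum (F : GlaisherFilter) (s n : ℕ) :
    F.frequencyMoment s n = ∑ x ∈ Finset.HasAntidiagonal.antidiagonal n,
      F.divisorSum s x.1 * Fintype.card x.2.Partition := by
  classical
  rw [frequencyMoment, Finset.sum_congr rfl fun k hk => by
    rw [partFrequency_eq_sum (Finset.mem_Icc.mp (Finset.mem_filter.mp hk).1).1 n,
      Finset.mul_sum], Finset.sum_comm]
  refine Finset.sum_congr rfl fun x hx => ?_
  rw [divisorSum, Finset.sum_mul]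
  simp only [mul_ite, mul_zero]
  rw [← Finset.sum_filter]
  refine Finset.sum_congr ?_ fun _ _ => rfl
  ext k
  have hx' := Finset.HasAntidiagonal.mem_antidiagonal.mp hx
  simp only [Finset.mem_filter, Finset.mem_Icc, Nat.mem_divisors]
  constructor
  · rintro ⟨⟨_, h⟩, h0, hd⟩
    exact ⟨⟨hd, h0⟩, h⟩
  · rintro ⟨⟨hd, h0⟩, h⟩
    have := Nat.le_of_dvd (Nat.pos_of_ne_zero h0) hd
    have := Nat.pos_of_dvd_of_pos hd (Nat.pos_of_ne_zero h0)
    exact ⟨⟨⟨by omega, by omega⟩, h⟩, h0, hd⟩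

theorem divisorSum_le (F : GlaisherFilter) (s n : ℕ) : F.divisorSum s n ≤ n ^ (s + 1) := by
  classical
  rw [divisorSum]
  calc _ ≤ ∑ d ∈ n.divisors, n ^ s := by
        refine (Finset.sum_le_sum_of_subset (Finset.filter_subset _ _)).trans
          (Finset.sum_le_sum fun d hd => Nat.pow_le_pow_left (Nat.divisor_le hd) s)
    _ ≤ n * n ^ s := by
        rw [Finset.sum_const, smul_eq_mul]
        exact Nat.mul_le_mul_right _ (Nat.card_divisors_le_self n)
    _ = n ^ (s + 1) := by ring

theorem summable_norm_divisorSum (F : GlaisherFilter) (s : ℕ) {q : ℂ} (hq : ‖q‖ < 1) :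
    Summable fun n : ℕ => ‖(F.divisorSum s n : ℂ) * q ^ n‖ := by
  refine Summable.of_nonneg_of_le (fun _ => norm_nonneg _) (fun n => ?_)
    (summable_norm_pow_mul_geometric_of_norm_lt_one (s + 1) hq)
  simp only [norm_mul, norm_pow, RCLike.norm_natCast]
  gcongr
  exact_mod_cast F.divisorSum_le s n

theorem hasSum_frequencyMoment (F : GlaisherFilter) (s : ℕ) {q : ℂ} (hq : ‖q‖ < 1) :
    HasSum (fun n : ℕ => (F.frequencyMoment s n : ℂ) * q ^ n)
      ((∑' n : ℕ, (F.divisorSum s n : ℂ) * q ^ n) * (∏' i : ℕ, (1 - q ^ (i + 1)))⁻¹) := by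
  have h1 := F.summable_norm_divisorSum s hq
  have h2 := Nat.Partition.summable_norm_card hq
  have he : ∀ n : ℕ, (F.frequencyMoment s n : ℂ) * q ^ n =
      ∑ x ∈ Finset.HasAntidiagonal.antidiagonal n, ((F.divisorSum s x.1 : ℂ) * q ^ x.1) *
        ((Fintype.card x.2.Partition : ℂ) * q ^ x.2) := by
    intro n
    rw [frequencyMoment_eq_sum]
    push_cast
    rw [Finset.sum_mul]
    refine Finset.sum_congr rfl fun x hx => ?_
    rw [← Finset.HasAntidiagonal.mem_antidiagonal.mp hx, pow_add]
    ring
  rw [← Nat.Partition.tsum_card_mul_pow hq,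
    tsum_mul_tsum_eq_tsum_sum_antidiagonal_of_summable_norm h1 h2]
  simp_rw [he]
  exact (summable_norm_sum_mul_antidiagonal_of_summable_norm h1 h2).of_norm.hasSum

end GlaisherFilter

/-! ### Filters as combinations of Dirichlet characters. -/

/-- The field generated over `ℚ` by the values of a Dirichlet character. -/
noncomputable def DirichletCharacter.valueField {N : ℕ} (χ : DirichletCharacter ℂ N) : IntermediateField ℚ ℂ :=
  IntermediateField.adjoin ℚ (Set.range fun a : ZMod N => χ a)

/-- The `ℚ`-space of the arithmetic functions `∑ c_χ χ` with Dirichlet characters `χ` of moduli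
dividing `L` and coefficients `c_χ` in the value field of `χ`. -/
def characterCombinations (L : ℕ) : Submodule ℚ (ℕ → ℂ) where
  carrier := {f | ∃ c : (Σ N : ℕ, DirichletCharacter ℂ N) →₀ ℂ,
    (∀ x, c x ∈ x.2.valueField) ∧ (∀ x, c x ≠ 0 → x.1 ∣ L) ∧
    ∀ d : ℕ, f d = c.sum fun x a => a * x.2 (d : ZMod x.1)}
  zero_mem' := ⟨0, fun x => by simp [zero_mem], by simp, by simp⟩
  add_mem' := by
    classical
    rintro f g ⟨c, h1, h2, h3⟩ ⟨c', h1', h2', h3'⟩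
    refine ⟨c + c', fun x => add_mem (h1 x) (h1' x), fun x hx => ?_, fun d => ?_⟩
    · by_cases h : c x = 0
      · exact h2' x fun h' => hx (by simp [h, h'])
      · exact h2 x h
    · rw [Finsupp.sum_add_index' (by simp) (by intros; ring), ← h3, ← h3', Pi.add_apply]
  smul_mem' := by
    rintro r f ⟨c, h1, h2, h3⟩
    refine ⟨r • c, fun x => ?_, fun x hx => h2 x fun h => hx (by simp [h]), fun d => ?_⟩
    · exact IntermediateField.smul_mem _ (h1 x)
    · rw [Finsupp.sum_smul_index' (by simp), Pi.smul_apply, h3, Finsupp.smul_sum]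
      simp [Finsupp.sum]

/-- The indicator functions of `gcd (d, r) = 1 ∧ d ≡ a (mod m)` with `gcd (a, m) = 1`, for moduli
`r` and `m` dividing `L`. -/
def reducedProgressions (L : ℕ) : Set (ℕ → ℂ) :=
  {f | ∃ r m a : ℕ, r ∣ L ∧ m ∣ L ∧ a.Coprime m ∧
    f = fun d => if d.Coprime r ∧ d ≡ a [MOD m] then 1 else 0}

theorem one_mem_span_reducedProgressions (L : ℕ) :
    (1 : ℕ → ℂ) ∈ Submodule.span ℚ (reducedProgressions L) := by
  refine Submodule.subset_span ⟨1, 1, 0, one_dvd _, one_dvd _, by simp, ?_⟩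
  ext d
  simp [Nat.modEq_one]

theorem Nat.coprime_lcm_iff {d r r' : ℕ} : d.Coprime (r.lcm r') ↔ d.Coprime r ∧ d.Coprime r' :=
  ⟨fun h => ⟨h.coprime_dvd_right (Nat.dvd_lcm_left _ _), h.coprime_dvd_right (Nat.dvd_lcm_right _ _)⟩,
    fun h => (h.1.mul_right h.2).coprime_dvd_right (Nat.lcm_dvd_mul _ _)⟩

theorem Nat.modEq_lcm_iff {d a m m' : ℕ} :
    d ≡ a [MOD m.lcm m'] ↔ d ≡ a [MOD m] ∧ d ≡ a [MOD m'] := by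
  simp only [← Int.natCast_modEq_iff]
  rw [Int.modEq_and_modEq_iff_modEq_lcm, Int.lcm_natCast_natCast]

/-- Two residue classes either have a common element x, and then meet in the class of x modulo the
lcm, still reduced and of modulus dividing L, or are disjoint and the product is 0. Products are
treated here, with rational coefficients, because the value-field condition on character
coefficients is not visibly multiplicative. -/
theorem mul_reducedProgressions {L : ℕ} {f g : ℕ → ℂ} (hf : f ∈ reducedProgressions L)
    (hg : g ∈ reducedProgressions L) : f * g ∈ Submodule.span ℚ (reducedProgressions L) := by
  obtain ⟨r, m, a, hr, hm, ha, rfl⟩ := hf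
  obtain ⟨r', m', a', hr', hm', ha', rfl⟩ := hg
  by_cases h : ∃ x, x ≡ a [MOD m] ∧ x ≡ a' [MOD m']
  · obtain ⟨x, hx, hx'⟩ := h
    refine Submodule.subset_span ⟨r.lcm r', m.lcm m', x, Nat.lcm_dvd hr hr', Nat.lcm_dvd hm hm',
      Nat.coprime_lcm_iff.mpr ⟨?_, ?_⟩, ?_⟩
    · rw [Nat.Coprime, hx.gcd_eq]; exact ha
    · rw [Nat.Coprime, hx'.gcd_eq]; exact ha'
    · ext d
      have h1 : d ≡ x [MOD m] ↔ d ≡ a [MOD m] := ⟨fun h => h.trans hx, fun h => h.trans hx.symm⟩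
      have h2 : d ≡ x [MOD m'] ↔ d ≡ a' [MOD m'] :=
        ⟨fun h => h.trans hx', fun h => h.trans hx'.symm⟩
      simp only [Pi.mul_apply, Nat.coprime_lcm_iff, Nat.modEq_lcm_iff, h1, h2, ite_zero_mul_ite_zero,
        mul_one]
      congr 1
      exact propext ⟨fun h => ⟨⟨h.1.1, h.2.1⟩, h.1.2, h.2.2⟩, fun h => ⟨⟨h.1.1, h.2.1⟩, h.1.2, h.2.2⟩⟩
  · convert! Submodule.zero_mem _
    ext d
    simp only [Pi.mul_apply, ite_zero_mul_ite_zero, mul_one, Pi.zero_apply, ite_eq_right_iff]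
    exact fun hd => absurd ⟨d, hd.1.2, hd.2.2⟩ h

theorem mul_mem_span_reducedProgressions {L : ℕ} {f g : ℕ → ℂ}
    (hf : f ∈ Submodule.span ℚ (reducedProgressions L))
    (hg : g ∈ Submodule.span ℚ (reducedProgressions L)) :
    f * g ∈ Submodule.span ℚ (reducedProgressions L) := by
  refine Submodule.span_induction₂ (p := fun x y _ _ => x * y ∈ _)
    (fun x y hx hy => mul_reducedProgressions hx hy) ?_ ?_ ?_ ?_ ?_ ?_ hf hg
  · simp
  · simp
  · intro x y z _ _ _ hx hy
    rw [add_mul]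
    exact add_mem hx hy
  · intro x y z _ _ _ hx hy
    rw [mul_add]
    exact add_mem hx hy
  · intro r x y _ _ h
    rw [smul_mul_assoc]
    exact Submodule.smul_mem _ _ h
  · intro r x y _ _ h
    rw [mul_smul_comm]
    exact Submodule.smul_mem _ _ h

-- Boolean operations become arithmetic of indicators: 1 - f, fg and f + g - fg.
open Classical in
theorem GlaisherFilter.indicator_mem_span {L : ℕ} (F : GlaisherFilter) (hF : F.level ∣ L) :
    (fun d => if F.Holds d then (1 : ℂ) else 0) ∈ Submodule.span ℚ (reducedProgressions L) := by
  induction F with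
  | residue m a hm ha =>
    refine Submodule.subset_span ⟨1, m, a, one_dvd _, hF, ha, ?_⟩
    ext d
    by_cases h : d ≡ a [MOD m] <;> simp [Holds, h]
  | coprime r hr =>
    refine Submodule.subset_span ⟨r, 1, 0, hF, one_dvd _, by simp, ?_⟩
    ext d
    simp only [Holds, Nat.modEq_one, and_true]
    congr
  | not F ih =>
    convert! sub_mem (one_mem_span_reducedProgressions L) (ih hF) using 1
    ext d
    by_cases h : F.Holds d <;> simp [Holds, h]
  | and F G ihF ihG =>
    convert! mul_mem_span_reducedProgressions (ihF ((Nat.dvd_lcm_left _ _).trans hF))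
      (ihG ((Nat.dvd_lcm_right _ _).trans hF)) using 1
    ext d
    by_cases h : F.Holds d <;> by_cases h' : G.Holds d <;> simp [Holds, h, h']
  | or F G ihF ihG =>
    have hF' := ihF ((Nat.dvd_lcm_left _ _).trans hF)
    have hG' := ihG ((Nat.dvd_lcm_right _ _).trans hF)
    convert! sub_mem (add_mem hF' hG') (mul_mem_span_reducedProgressions hF' hG') using 1
    ext d
    by_cases h : F.Holds d <;> by_cases h' : G.Holds d <;> simp [Holds, h, h']

theorem GlaisherFilter.level_pos (F : GlaisherFilter) : 0 < F.level := by
  induction F with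
  | residue m a hm ha => exact hm
  | coprime r hr => exact hr
  | not F ih => exact ih
  | and F G ihF ihG => exact Nat.lcm_pos ihF ihG
  | or F G ihF ihG => exact Nat.lcm_pos ihF ihG

-- Inflating the level is how a coprimality condition is absorbed into a character.
open Classical in
theorem DirichletCharacter.changeLevel_lcm_natCast {m r : ℕ} (χ : DirichletCharacter ℂ m) (d : ℕ) :
    changeLevel (Nat.dvd_lcm_left m r) χ (d : ZMod (m.lcm r)) =
      if d.Coprime r then χ (d : ZMod m) else 0 := by
  by_cases h : d.Coprime (m.lcm r)
  · rw [if_pos (Nat.coprime_lcm_iff.mp h).2]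
    exact_mod_cast changeLevel_eq_cast_of_dvd' χ (Nat.dvd_lcm_left m r)
      (Nat.isCoprime_iff_coprime.mpr h)
  · rw [MulChar.map_nonunit _ (by rwa [ZMod.isUnit_iff_coprime])]
    split_ifs with hr
    · rw [MulChar.map_nonunit]
      rw [ZMod.isUnit_iff_coprime]
      exact fun hm => h (Nat.coprime_lcm_iff.mpr ⟨hm, hr⟩)
    · rfl

/-- Units mod n surject onto units mod m, so inflation loses no nonzero value. Coefficients formed
from χ thus lie in the value field of the inflated character. -/
theorem DirichletCharacter.apply_mem_valueField_changeLevel {m n : ℕ} [NeZero n] (h : m ∣ n)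
    (χ : DirichletCharacter ℂ m) (a : ZMod m) : χ a ∈ (changeLevel h χ).valueField := by
  by_cases ha : IsUnit a
  · obtain ⟨u, rfl⟩ := ha
    obtain ⟨v, rfl⟩ := ZMod.unitsMap_surjective h u
    refine IntermediateField.subset_adjoin _ _ ⟨(v : ZMod n), ?_⟩
    simp only [changeLevel_eq_cast_of_dvd, ZMod.unitsMap_val]
  · rw [MulChar.map_nonunit _ ha]
    exact zero_mem _

/-- Orthogonality of characters mod m detects the class of a with coefficients χ(a⁻¹)/φ(m);
inflation to lcm(m, r) inserts the condition gcd(d, r) = 1. -/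
theorem reducedProgressions_subset {L : ℕ} (hL : 0 < L) :
    reducedProgressions L ⊆ characterCombinations L := by
  classical
  rintro f ⟨r, m, a, hr, hm, ha, rfl⟩
  have : NeZero m := ⟨(Nat.pos_of_dvd_of_pos hm hL).ne'⟩
  have : NeZero (m.lcm r) := ⟨(Nat.pos_of_dvd_of_pos (Nat.lcm_dvd hm hr) hL).ne'⟩
  have hdec : (fun d : ℕ => if d.Coprime r ∧ d ≡ a [MOD m] then (1 : ℂ) else 0) =
      ∑ χ : DirichletCharacter ℂ m, fun d : ℕ => ((m.totient : ℂ)⁻¹ * χ ((a : ZMod m)⁻¹)) *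
        DirichletCharacter.changeLevel (Nat.dvd_lcm_left m r) χ (d : ZMod (m.lcm r)) := by
    ext d
    rw [Finset.sum_apply]
    simp only [DirichletCharacter.changeLevel_lcm_natCast]
    by_cases hd : d.Coprime r
    · simp only [if_pos hd, and_iff_right hd, mul_assoc]
      rw [← Finset.mul_sum, DirichletCharacter.sum_char_inv_mul_char_eq ℂ
        ((ZMod.isUnit_iff_coprime _ _).mpr ha)]
      have e : ((a : ZMod m) = (d : ZMod m)) ↔ d ≡ a [MOD m] := by
        rw [ZMod.natCast_eq_natCast_iff]
        exact ⟨fun h => h.symm, fun h => h.symm⟩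
      have hm0 : (m.totient : ℂ) ≠ 0 := by
        exact_mod_cast (Nat.totient_pos.mpr (Nat.pos_of_dvd_of_pos hm hL)).ne'
      simp only [e]
      split_ifs <;> simp [hm0]
    · simp [hd]
  rw [hdec]
  refine Submodule.sum_mem _ fun χ _ => ?_
  refine ⟨Finsupp.single ⟨m.lcm r, DirichletCharacter.changeLevel (Nat.dvd_lcm_left m r) χ⟩
    ((m.totient : ℂ)⁻¹ * χ ((a : ZMod m)⁻¹)), fun x => ?_, fun x hx => ?_, fun d => ?_⟩
  · rw [Finsupp.single_apply]
    split_ifs with h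
    · subst h
      exact mul_mem (inv_mem (natCast_mem _ _))
        (DirichletCharacter.apply_mem_valueField_changeLevel _ χ _)
    · exact zero_mem _
  · have := (Finsupp.single_apply_ne_zero.mp hx).1
    subst this
    exact Nat.lcm_dvd hm hr
  · rw [Finsupp.sum_single_index (by simp)]

open Classical in
/-- The indicator function of a Glaisher filter is a combination of Dirichlet characters of moduli
dividing the level, with coefficients in the value fields. -/
theorem GlaisherFilter.exists_characterCombination (F : GlaisherFilter) :
    ∃ c : (Σ N : ℕ, DirichletCharacter ℂ N) →₀ ℂ,
      (∀ x, c x ∈ x.2.valueField) ∧ (∀ x, c x ≠ 0 → x.1 ∣ F.level) ∧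
      ∀ d : ℕ, (if F.Holds d then (1 : ℂ) else 0) = c.sum fun x a => a * x.2 (d : ZMod x.1) :=
  Submodule.span_le.mpr (reducedProgressions_subset F.level_pos) (F.indicator_mem_span dvd_rfl)

/-! ### The logarithmic derivative of theta as a sum of Cayley transforms. -/

open Complex in
/-- The Cayley transform `(1 + x) / (2 (1 - x))`. -/
noncomputable def halfCayley (x : ℂ) : ℂ := (1 + x) / (2 * (1 - x))

/-- Holds at the pole x = 1 too, where division by zero gives the value 0. Hence the oddness of
`quasiZeta` has no exceptional points. -/
theorem halfCayley_inv {x : ℂ} (hx : x ≠ 0) : halfCayley x⁻¹ = -halfCayley x := by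
  rcases eq_or_ne x 1 with rfl | h1
  · simp [halfCayley]
  · have h2 : 1 - x ≠ 0 := sub_ne_zero.mpr h1.symm
    have h3 : x - 1 ≠ 0 := sub_ne_zero.mpr h1
    have h4 : 1 - x⁻¹ = (x - 1) / x := by field_simp
    rw [halfCayley, halfCayley, h4]
    field_simp
    ring

theorem halfCayley_sub_half {x : ℂ} (hx : x ≠ 1) : halfCayley x - 1 / 2 = x / (1 - x) := by
  have h2 : 1 - x ≠ 0 := sub_ne_zero.mpr hx.symm
  rw [halfCayley]
  field_simp
  ring

theorem norm_halfCayley_sub_half_le {x : ℂ} (hx : ‖x‖ ≤ 1 / 2) :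
    ‖halfCayley x - 1 / 2‖ ≤ 2 * ‖x‖ := by
  have h1 : x ≠ 1 := by rintro rfl; norm_num at hx
  have h2 : 1 / 2 ≤ ‖1 - x‖ := by
    have := norm_sub_norm_le (1 : ℂ) x
    rw [norm_one] at this
    linarith
  rw [halfCayley_sub_half h1, norm_div, div_le_iff₀ (by linarith)]
  nlinarith [norm_nonneg x]

theorem summable_halfCayley {q : ℂ} (hq : ‖q‖ < 1) (w : ℂ) :
    Summable fun n : ℕ => halfCayley (q ^ (n + 1) * w) - 1 / 2 := by
  have hg := ((summable_nat_add_iff 1).mpr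
    (summable_geometric_of_lt_one (norm_nonneg q) hq)).mul_right (2 * ‖w‖)
  refine Summable.of_norm_bounded_eventually_nat hg ?_
  have ht : Filter.Tendsto (fun n : ℕ => ‖q ^ (n + 1) * w‖) Filter.atTop (nhds 0) := by
    have := ((tendsto_pow_atTop_nhds_zero_of_norm_lt_one hq).comp
      (Filter.tendsto_add_atTop_nat 1)).mul_const w
    simpa using this.norm
  filter_upwards [ht.eventually (eventually_le_nhds (by norm_num : (0 : ℝ) < 1 / 2))] with n hn
  refine (norm_halfCayley_sub_half_le hn).trans (le_of_eq ?_)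
  rw [norm_mul, norm_pow]
  ring

/-- The sum over the translates `q ^ n * w`, `n ≥ 1`, of the Cayley transform, regularized. -/
noncomputable def cayleyTail (q w : ℂ) : ℂ := ∑' n : ℕ, (halfCayley (q ^ (n + 1) * w) - 1 / 2)

theorem cayleyTail_mul {q : ℂ} (hq : ‖q‖ < 1) (w : ℂ) :
    cayleyTail q w = halfCayley (q * w) - 1 / 2 + cayleyTail q (q * w) := by
  rw [cayleyTail, (summable_halfCayley hq w).tsum_eq_zero_add, cayleyTail, zero_add, pow_one]
  simp only [pow_succ, mul_assoc]

/-- The quasi-periodic sum of the Cayley transform over all translates `q ^ n * w`. -/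
noncomputable def cayleySum (q w : ℂ) : ℂ := halfCayley w + cayleyTail q w - cayleyTail q w⁻¹

theorem cayleySum_inv {q w : ℂ} (hw : w ≠ 0) : cayleySum q w⁻¹ = -cayleySum q w := by
  rw [cayleySum, cayleySum, inv_inv, halfCayley_inv hw]
  ring

/-- The summands are shifted by one place; only the regularizing constants, -1/2 for positive and
+1/2 for negative indices, fail to match, and they contribute 1/2 twice. -/
theorem cayleySum_mul {q w : ℂ} (hq : ‖q‖ < 1) (hq0 : q ≠ 0) (hw : w ≠ 0) :
    cayleySum q (q * w) = cayleySum q w + 1 := by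
  have h1 := cayleyTail_mul hq w
  have h2 := cayleyTail_mul hq (q * w)⁻¹
  have h3 : q * (q * w)⁻¹ = w⁻¹ := by field_simp
  rw [h3, halfCayley_inv hw] at h2
  rw [cayleySum, cayleySum]
  linear_combination -h1 - h2

/-- The logarithmic derivative of the odd Jacobi theta function, as a `q`-series: an odd function
of `z` with simple poles of residue `1` in the points of the lattice `ℤ τ + ℤ`. -/
noncomputable def quasiZeta (τ z : ℂ) : ℂ :=
  -(2 * Real.pi * Complex.I) *
    cayleySum (Complex.exp (2 * Real.pi * Complex.I * τ)) (Complex.exp (2 * Real.pi * Complex.I * z))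

theorem norm_exp_two_pi_I_mul (z : ℂ) :
    ‖Complex.exp (2 * Real.pi * Complex.I * z)‖ = Real.exp (-2 * Real.pi * z.im) := by
  rw [Complex.norm_exp]
  congr 1
  simp

theorem norm_exp_two_pi_I_mul_lt_one {τ : ℂ} (hτ : 0 < τ.im) :
    ‖Complex.exp (2 * Real.pi * Complex.I * τ)‖ < 1 := by
  rw [norm_exp_two_pi_I_mul, Real.exp_lt_one_iff]
  nlinarith [mul_pos Real.pi_pos hτ]

theorem quasiZeta_neg (τ z : ℂ) : quasiZeta τ (-z) = -quasiZeta τ z := by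
  rw [quasiZeta, quasiZeta, mul_neg, Complex.exp_neg, cayleySum_inv (Complex.exp_ne_zero _)]
  ring

theorem quasiZeta_add_int (τ z : ℂ) (n : ℤ) : quasiZeta τ (z + n) = quasiZeta τ z := by
  rw [quasiZeta, quasiZeta, mul_add, Complex.exp_add]
  have : Complex.exp (2 * Real.pi * Complex.I * n) = 1 :=
    Complex.exp_eq_one_iff.mpr ⟨n, by ring⟩
  rw [this, mul_one]

theorem quasiZeta_add_self {τ : ℂ} (hτ : 0 < τ.im) (z : ℂ) :
    quasiZeta τ (z + τ) = quasiZeta τ z - 2 * Real.pi * Complex.I := by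
  rw [quasiZeta, quasiZeta, mul_add, Complex.exp_add, mul_comm (Complex.exp _),
    cayleySum_mul (norm_exp_two_pi_I_mul_lt_one hτ) (Complex.exp_ne_zero _) (Complex.exp_ne_zero _)]
  ring

theorem quasiZeta_add_int_mul {τ : ℂ} (hτ : 0 < τ.im) (z : ℂ) (m : ℤ) :
    quasiZeta τ (z + m * τ) = quasiZeta τ z - 2 * Real.pi * Complex.I * m := by
  induction m using Int.induction_on with
  | zero => simp
  | succ i ih =>
    have := quasiZeta_add_self hτ (z + i * τ)
    push_cast at ih ⊢
    rw [show z + (i + 1) * τ = z + i * τ + τ by ring, this, ih]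
    ring
  | pred i ih =>
    have := quasiZeta_add_self hτ (z + (-i - 1) * τ)
    rw [show z + (-i - 1) * τ + τ = z + -i * τ by ring] at this
    push_cast at ih ⊢
    linear_combination -this + ih

theorem quasiZeta_add_lattice {τ : ℂ} (hτ : 0 < τ.im) (z : ℂ) (m n : ℤ) :
    quasiZeta τ (z + (m * τ + n)) = quasiZeta τ z - 2 * Real.pi * Complex.I * m := by
  rw [← add_assoc, quasiZeta_add_int, quasiZeta_add_int_mul hτ]

/-! ### Exponential series and Lambert series. -/

section ExponentialSeries

/-- Termwise differentiation of an exponential series in a left half-plane. -/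
theorem hasDerivAt_expSeries {b : ℕ → ℂ} {δ : ℝ}
    (hb : ∀ j : ℕ, Summable fun m : ℕ => ‖b m‖ * (m : ℝ) ^ j * Real.exp (m * δ)) (j : ℕ) {t : ℂ}
    (ht : t.re < δ) :
    HasDerivAt (fun t : ℂ => ∑' m : ℕ, b m * (m : ℂ) ^ j * Complex.exp (m * t))
      (∑' m : ℕ, b m * (m : ℂ) ^ (j + 1) * Complex.exp (m * t)) t := by
  have hbound : ∀ (j m : ℕ) (y : ℂ), y ∈ {y : ℂ | y.re < δ} →
      ‖b m * (m : ℂ) ^ j * Complex.exp (m * y)‖ ≤ ‖b m‖ * (m : ℝ) ^ j * Real.exp (m * δ) := by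
    intro j m y hy
    rw [norm_mul, norm_mul, norm_pow, Complex.norm_natCast, Complex.norm_exp]
    have : ((m : ℂ) * y).re = m * y.re := by simp
    rw [this]
    have hy' : y.re ≤ δ := le_of_lt hy
    gcongr
  refine hasDerivAt_tsum_of_isPreconnected (hb (j + 1))
    (t := {y : ℂ | y.re < δ}) (isOpen_lt Complex.continuous_re continuous_const)
    (convex_halfSpace_re_lt δ).isPreconnected (fun m y _ => ?_) (hbound (j + 1)) ht
    (Summable.of_norm_bounded (hb j) fun m => hbound j m t ht) ht
  have h1 := (((hasDerivAt_id y).const_mul (m : ℂ)).cexp).const_mul (b m * (m : ℂ) ^ j)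
  convert! h1 using 1
  simp only [id]
  ring

theorem differentiableOn_expSeries {b : ℕ → ℂ} {δ : ℝ}
    (hb : ∀ j : ℕ, Summable fun m : ℕ => ‖b m‖ * (m : ℝ) ^ j * Real.exp (m * δ)) :
    DifferentiableOn ℂ (fun t : ℂ => ∑' m : ℕ, b m * Complex.exp (m * t)) {t | t.re < δ} := by
  intro t ht
  have := hasDerivAt_expSeries hb 0 ht
  simp only [pow_zero, mul_one] at this
  exact this.differentiableAt.differentiableWithinAt

theorem iteratedDeriv_expSeries {b : ℕ → ℂ} {δ : ℝ}
    (hb : ∀ j : ℕ, Summable fun m : ℕ => ‖b m‖ * (m : ℝ) ^ j * Real.exp (m * δ)) (j : ℕ) {t : ℂ}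
    (ht : t.re < δ) :
    iteratedDeriv j (fun t : ℂ => ∑' m : ℕ, b m * Complex.exp (m * t)) t =
      ∑' m : ℕ, b m * (m : ℂ) ^ j * Complex.exp (m * t) := by
  induction j generalizing t with
  | zero => simp
  | succ j ih =>
    rw [iteratedDeriv_succ]
    have : iteratedDeriv j (fun t : ℂ => ∑' m : ℕ, b m * Complex.exp (m * t)) =ᶠ[nhds t]
        fun t => ∑' m : ℕ, b m * (m : ℂ) ^ j * Complex.exp (m * t) := by
      filter_upwards [(isOpen_lt Complex.continuous_re continuous_const).mem_nhds ht] with y hy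
      exact ih hy
    rw [this.deriv_eq]
    exact (hasDerivAt_expSeries hb j ht).deriv

end ExponentialSeries

/-- The coefficients `q ^ m / (1 - q ^ m)` of a Lambert series (zero for `m = 0`). -/
noncomputable def lambertCoeff (q : ℂ) (m : ℕ) : ℂ := q ^ m / (1 - q ^ m)

theorem one_sub_pow_norm_le {q : ℂ} (hq : ‖q‖ < 1) {m : ℕ} (hm : m ≠ 0) :
    1 - ‖q‖ ≤ ‖1 - q ^ m‖ := by
  have h1 := norm_sub_norm_le (1 : ℂ) (q ^ m)
  rw [norm_one, norm_pow] at h1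
  have h2 : ‖q‖ ^ m ≤ ‖q‖ := pow_le_of_le_one (norm_nonneg _) hq.le hm
  linarith

theorem norm_lambertCoeff_le {q : ℂ} (hq : ‖q‖ < 1) (m : ℕ) :
    ‖lambertCoeff q m‖ ≤ (1 - ‖q‖)⁻¹ * ‖q‖ ^ m := by
  rcases eq_or_ne m 0 with rfl | hm
  · simp [lambertCoeff, hq.le]
  · rw [lambertCoeff, norm_div, norm_pow, div_eq_inv_mul]
    have := one_sub_pow_norm_le hq hm
    gcongr

theorem summable_lambertCoeff {q : ℂ} (hq : ‖q‖ < 1) {δ : ℝ} (hδ : ‖q‖ * Real.exp δ < 1)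
    {u : ℕ → ℂ} (hu : ∀ m, ‖u m‖ ≤ 1) (j : ℕ) :
    Summable fun m : ℕ => ‖lambertCoeff q m * u m‖ * (m : ℝ) ^ j * Real.exp (m * δ) := by
  have h := (summable_pow_mul_geometric_of_norm_lt_one j (r := ‖q‖ * Real.exp δ)
    (by rwa [Real.norm_of_nonneg (by positivity)])).mul_left (1 - ‖q‖)⁻¹
  refine Summable.of_nonneg_of_le (fun m => by positivity) (fun m => ?_) h
  have h1 := norm_lambertCoeff_le hq m
  rw [norm_mul, Real.exp_nat_mul, mul_pow]
  calc ‖lambertCoeff q m‖ * ‖u m‖ * (m : ℝ) ^ j * Real.exp δ ^ m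
      ≤ ((1 - ‖q‖)⁻¹ * ‖q‖ ^ m) * 1 * (m : ℝ) ^ j * Real.exp δ ^ m := by
        have := hu m
        have := sub_pos.mpr hq
        gcongr
    _ = _ := by ring

/-- The general term is at most |qw| |q|^n |qw|^m, a product of geometric series. -/
theorem summable_translates {q w : ℂ} (hq : ‖q‖ < 1) (hw : ‖q * w‖ < 1) :
    Summable fun p : ℕ × ℕ => (q ^ (p.1 + 1) * w) ^ (p.2 + 1) := by
  have hs := (summable_geometric_of_lt_one (norm_nonneg q) hq).mul_of_nonneg
    (summable_geometric_of_lt_one (norm_nonneg (q * w)) hw)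
    (fun _ => pow_nonneg (norm_nonneg _) _) (fun _ => pow_nonneg (norm_nonneg _) _)
  refine Summable.of_norm_bounded (hs.mul_left ‖q * w‖) fun p => ?_
  have e : (q ^ (p.1 + 1) * w) ^ (p.2 + 1) =
      q * w * (q ^ p.1 * (q * w) ^ p.2) * (q ^ p.1) ^ p.2 := by ring
  rw [e, norm_mul, norm_mul (q * w), norm_mul (q ^ p.1), norm_pow q, norm_pow (q * w)]
  refine mul_le_of_le_one_right (by positivity) ?_
  rw [norm_pow, norm_pow]
  exact pow_le_one₀ (by positivity) (pow_le_one₀ (norm_nonneg _) hq.le)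

theorem tsum_pow_succ_of_norm_lt_one {x : ℂ} (hx : ‖x‖ < 1) :
    ∑' m : ℕ, x ^ (m + 1) = x / (1 - x) := by
  simp_rw [pow_succ']
  rw [tsum_mul_left, tsum_geometric_of_norm_lt_one hx, div_eq_mul_inv]

/-- Expand each x/(1 - x) geometrically and sum over the translates first. -/
theorem cayleyTail_eq_tsum {q : ℂ} (hq : ‖q‖ < 1) {w : ℂ} (hw : ‖q * w‖ < 1) :
    cayleyTail q w = ∑' m : ℕ, lambertCoeff q m * w ^ m := by
  have hx : ∀ n : ℕ, ‖q ^ (n + 1) * w‖ < 1 := fun n => by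
    rw [pow_succ, mul_assoc, norm_mul, norm_pow]
    exact (mul_le_of_le_one_left (norm_nonneg _) (pow_le_one₀ (norm_nonneg _) hq.le)).trans_lt hw
  have h1 : ∀ n : ℕ, halfCayley (q ^ (n + 1) * w) - 1 / 2 =
      ∑' m : ℕ, (q ^ (n + 1) * w) ^ (m + 1) := fun n => by
    rw [tsum_pow_succ_of_norm_lt_one (hx n), halfCayley_sub_half]
    intro h
    have := hx n
    rw [h, norm_one] at this
    exact lt_irrefl _ this
  have h2 : ∀ m : ℕ, lambertCoeff q (m + 1) * w ^ (m + 1) =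
      ∑' n : ℕ, (q ^ (n + 1) * w) ^ (m + 1) := fun m => by
    have e : ∀ n : ℕ, (q ^ (n + 1) * w) ^ (m + 1) = (q ^ (m + 1)) ^ (n + 1) * w ^ (m + 1) :=
      fun n => by ring
    simp_rw [e]
    rw [tsum_mul_right, tsum_pow_succ_of_norm_lt_one (by
      rw [norm_pow]; exact pow_lt_one₀ (norm_nonneg _) hq (by omega)), lambertCoeff]
  have hsum := summable_translates hq hw
  let F : ℕ → ℕ → ℂ := fun n m => (q ^ (n + 1) * w) ^ (m + 1)
  have hq' : Summable fun m : ℕ => lambertCoeff q (m + 1) * w ^ (m + 1) :=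
    (hsum.prod_symm.prod).congr fun m => (h2 m).symm
  have h0 : lambertCoeff q 0 * w ^ 0 = 0 := by simp [lambertCoeff]
  have hall : Summable fun m : ℕ => lambertCoeff q m * w ^ m := (summable_nat_add_iff 1).mp hq'
  have hcomm : ∑' m : ℕ, ∑' n : ℕ, (q ^ (n + 1) * w) ^ (m + 1) =
      ∑' n : ℕ, ∑' m : ℕ, (q ^ (n + 1) * w) ^ (m + 1) :=
    Summable.tsum_comm (f := F) (hsum : Summable (Function.uncurry F))
  calc cayleyTail q w = ∑' n : ℕ, ∑' m : ℕ, (q ^ (n + 1) * w) ^ (m + 1) := tsum_congr h1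
    _ = ∑' m : ℕ, ∑' n : ℕ, (q ^ (n + 1) * w) ^ (m + 1) := hcomm.symm
    _ = ∑' m : ℕ, lambertCoeff q (m + 1) * w ^ (m + 1) := (tsum_congr h2).symm
    _ = ∑' m : ℕ, lambertCoeff q m * w ^ m := by rw [hall.tsum_eq_zero_add, h0, zero_add]

/-! ### The generating function of the Bernoulli polynomials. -/

section BernoulliGeneratingFunction

/-- The entire function `(exp t - 1) / t`. -/
noncomputable def expSlope (t : ℂ) : ℂ := dslope Complex.exp 0 t

theorem differentiable_expSlope : Differentiable ℂ expSlope := by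
  have := (Complex.differentiableOn_dslope (f := Complex.exp) (c := 0) Filter.univ_mem).mpr
    Complex.differentiable_exp.differentiableOn
  exact differentiableOn_univ.mp this

theorem expSlope_zero : expSlope 0 = 1 := by
  rw [expSlope, dslope_same, Complex.deriv_exp, Complex.exp_zero]

theorem mul_expSlope (t : ℂ) : t * expSlope t = Complex.exp t - 1 := by
  have := sub_smul_dslope Complex.exp 0 t
  simpa [expSlope] using this

theorem expSlope_ne_zero {t : ℂ} (h : t = 0 ∨ Complex.exp t ≠ 1) : expSlope t ≠ 0 := by
  rcases h with rfl | h
  · rw [expSlope_zero]; exact one_ne_zero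
  · intro h0
    have := mul_expSlope t
    rw [h0, mul_zero] at this
    exact h (sub_eq_zero.mp this.symm)

theorem isOpen_expSlope_ne_zero : IsOpen {t : ℂ | expSlope t ≠ 0} :=
  isOpen_ne_fun differentiable_expSlope.continuous continuous_const

/-- The generating function `t exp (x t) / (exp t - 1)` of the Bernoulli polynomials. -/
noncomputable def bernoulliGen (x t : ℂ) : ℂ := Complex.exp (x * t) / expSlope t

theorem differentiableOn_bernoulliGen (x : ℂ) :
    DifferentiableOn ℂ (bernoulliGen x) {t : ℂ | expSlope t ≠ 0} := fun t ht =>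
  (DifferentiableAt.div (by fun_prop) (differentiable_expSlope t) ht).differentiableWithinAt

theorem zero_mem_expSlope_ne_zero : (0 : ℂ) ∈ {t : ℂ | expSlope t ≠ 0} :=
  expSlope_ne_zero (Or.inl rfl)

theorem analyticAt_bernoulliGen (x : ℂ) : AnalyticAt ℂ (bernoulliGen x) 0 :=
  (differentiableOn_bernoulliGen x).analyticAt
    (isOpen_expSlope_ne_zero.mem_nhds zero_mem_expSlope_ne_zero)

theorem iteratedDeriv_succ_id_mul {g : ℂ → ℂ} {n : ℕ} (hg : ContDiffAt ℂ (n + 1 : ℕ) g 0) :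
    iteratedDeriv (n + 1) (fun t => t * g t) 0 = (n + 1) * iteratedDeriv n g 0 := by
  rw [iteratedDeriv_fun_mul (f := fun t : ℂ => t) (by fun_prop) hg,
    Finset.sum_eq_single_of_mem 1 (by simp)]
  · rw [iteratedDeriv_fun_id_zero, if_pos rfl, Nat.choose_one_right, Nat.add_sub_cancel]
    push_cast
    ring
  · intro i _ hi
    rw [iteratedDeriv_fun_id_zero, if_neg hi]
    simp

/-- Leibniz's rule of order n + 1 at 0, applied to B(t)(e^t - 1) = t e^(xt). This is the recursion
of `Polynomial.sum_bernoulli`, which determines its solution. -/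
theorem sum_choose_mul_iteratedDeriv_bernoulliGen (x : ℂ) (n : ℕ) :
    ∑ k ∈ Finset.range (n + 1), ((n + 1).choose k : ℂ) * iteratedDeriv k (bernoulliGen x) 0 =
      (n + 1) * x ^ n := by
  have hmul : (fun t => bernoulliGen x t * (Complex.exp t - 1)) =ᶠ[nhds 0]
      fun t => t * Complex.exp (x * t) := by
    filter_upwards [isOpen_expSlope_ne_zero.mem_nhds zero_mem_expSlope_ne_zero] with t ht
    have ht' : expSlope t ≠ 0 := ht
    rw [bernoulliGen, ← mul_expSlope]
    field_simp
  have h := hmul.iteratedDeriv_eq (n + 1)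
  have hexp : ContDiffAt ℂ (n + 1 : ℕ) (fun t : ℂ => Complex.exp t - 1) 0 := by fun_prop
  rw [iteratedDeriv_fun_mul (analyticAt_bernoulliGen x).contDiffAt hexp,
    iteratedDeriv_succ_id_mul (by fun_prop), Finset.sum_range_succ] at h
  have e0 : iteratedDeriv 0 (fun t : ℂ => Complex.exp t - 1) 0 = 0 := by simp
  have e1 : ∀ m : ℕ, 0 < m → iteratedDeriv m (fun t : ℂ => Complex.exp t - 1) 0 = 1 := by
    intro m hm
    rw [iteratedDeriv_fun_sub (by fun_prop) (by fun_prop)]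
    have := iteratedDeriv_cexp_const_mul m 1
    simp only [one_mul, one_pow] at this
    rw [this, iteratedDeriv_const]
    simp [hm.ne']
  rw [Nat.sub_self, e0, mul_zero, add_zero, iteratedDeriv_cexp_const_mul] at h
  simp only [mul_zero, Complex.exp_zero, mul_one] at h
  rw [← h]
  refine Finset.sum_congr rfl fun k hk => ?_
  rw [e1 _ (by have := Finset.mem_range.mp hk; omega), mul_one]

/-- The Taylor coefficients of the Bernoulli generating function. -/
theorem iteratedDeriv_bernoulliGen (x : ℚ) (n : ℕ) :
    iteratedDeriv n (bernoulliGen x) 0 = (((Polynomial.bernoulli n).eval x : ℚ) : ℂ) := by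
  induction n using Nat.strong_induction_on with
  | _ n ih =>
    have h1 := sum_choose_mul_iteratedDeriv_bernoulliGen x n
    have h2 := congrArg (fun p : Polynomial ℚ => ((p.eval x : ℚ) : ℂ)) (Polynomial.sum_bernoulli n)
    simp only [Polynomial.eval_finsetSum, Polynomial.eval_smul, Polynomial.eval_monomial,
      smul_eq_mul] at h2
    push_cast at h2
    rw [Finset.sum_range_succ] at h1 h2
    have h3 : ∑ k ∈ Finset.range n, ((n + 1).choose k : ℂ) * iteratedDeriv k (bernoulliGen x) 0 =
        ∑ k ∈ Finset.range n, ((n + 1).choose k : ℂ) *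
          (((Polynomial.bernoulli k).eval x : ℚ) : ℂ) :=
      Finset.sum_congr rfl fun k hk => by rw [ih k (Finset.mem_range.mp hk)]
    have hne : ((n + 1).choose n : ℂ) ≠ 0 := by
      exact_mod_cast (Nat.choose_pos (Nat.le_succ n)).ne'
    refine mul_left_cancel₀ hne ?_
    linear_combination h1 - h2 - h3

/-- The regular part of `exp (x t) / (exp t - 1)` at `t = 0`. -/
noncomputable def bernoulliGenReg (x t : ℂ) : ℂ := dslope (bernoulliGen x) 0 t

theorem differentiableOn_bernoulliGenReg (x : ℂ) :
    DifferentiableOn ℂ (bernoulliGenReg x) {t : ℂ | expSlope t ≠ 0} :=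
  (Complex.differentiableOn_dslope
    (isOpen_expSlope_ne_zero.mem_nhds zero_mem_expSlope_ne_zero)).mpr
    (differentiableOn_bernoulliGen x)

theorem analyticAt_bernoulliGenReg (x : ℂ) : AnalyticAt ℂ (bernoulliGenReg x) 0 :=
  (differentiableOn_bernoulliGenReg x).analyticAt
    (isOpen_expSlope_ne_zero.mem_nhds zero_mem_expSlope_ne_zero)

theorem bernoulliGen_zero_right (x : ℂ) : bernoulliGen x 0 = 1 := by
  simp [bernoulliGen, expSlope_zero]

theorem mul_bernoulliGenReg (x t : ℂ) : t * bernoulliGenReg x t = bernoulliGen x t - 1 := by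
  have := sub_smul_dslope (bernoulliGen x) 0 t
  simpa [bernoulliGenReg, bernoulliGen_zero_right] using this

theorem iteratedDeriv_bernoulliGenReg (x : ℚ) (n : ℕ) :
    iteratedDeriv n (bernoulliGenReg x) 0 =
      (((Polynomial.bernoulli (n + 1)).eval x : ℚ) : ℂ) / (n + 1) := by
  have h : (fun t : ℂ => t * bernoulliGenReg x t) = fun t => bernoulliGen x t - 1 :=
    funext fun t => mul_bernoulliGenReg x t
  have h1 : iteratedDeriv (n + 1) (fun t : ℂ => t * bernoulliGenReg x t) 0 =
      iteratedDeriv (n + 1) (fun t => bernoulliGen x t - 1) 0 := by rw [h]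
  rw [iteratedDeriv_fun_sub (analyticAt_bernoulliGen x).contDiffAt contDiffAt_const,
    iteratedDeriv_succ_id_mul (analyticAt_bernoulliGenReg x).contDiffAt,
    iteratedDeriv_const, if_neg (by omega), sub_zero, iteratedDeriv_bernoulliGen] at h1
  have : (n : ℂ) + 1 ≠ 0 := by exact_mod_cast n.succ_ne_zero
  rw [← h1]
  field_simp

theorem exp_div_exp_sub_one (x : ℂ) {t : ℂ} (ht : Complex.exp t ≠ 1) :
    Complex.exp (x * t) / (Complex.exp t - 1) = t⁻¹ + bernoulliGenReg x t := by
  have ht0 : t ≠ 0 := by rintro rfl; simp at ht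
  have h1 := mul_bernoulliGenReg x t
  have h2 := expSlope_ne_zero (Or.inr ht)
  have h3 : bernoulliGenReg x t = (bernoulliGen x t - 1) / t := by
    rw [← h1]; field_simp
  rw [h3, bernoulliGen, ← mul_expSlope]
  field_simp
  ring

theorem bernoulliGenReg_zero_zero : bernoulliGenReg 0 0 = -1 / 2 := by
  have := iteratedDeriv_bernoulliGenReg 0 0
  have e : ((0 : ℚ) : ℂ) = 0 := Rat.cast_zero
  rw [iteratedDeriv_zero, e] at this
  rw [this]
  simp
  norm_num

/-- Isolates the pole of the Cayley transform at t = 0. The default values at t = 0 give 0 on both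
sides, so the identity holds on a full neighbourhood and no separate removable-singularity argument
is needed. -/
theorem halfCayley_exp {t : ℂ} (h : t = 0 ∨ Complex.exp t ≠ 1) :
    halfCayley (Complex.exp t) + t⁻¹ = -bernoulliGenReg 0 t - 1 / 2 := by
  rcases h with rfl | h
  · rw [bernoulliGenReg_zero_zero]
    simp [halfCayley]
    norm_num
  · have h1 := exp_div_exp_sub_one 0 h
    have h2 := halfCayley_sub_half h
    rw [zero_mul, Complex.exp_zero] at h1
    have h3 : Complex.exp t - 1 ≠ 0 := sub_ne_zero.mpr h
    have h4 : 1 - Complex.exp t ≠ 0 := sub_ne_zero.mpr h.symm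
    have h5 : Complex.exp t / (1 - Complex.exp t) = -1 - 1 / (Complex.exp t - 1) := by
      field_simp
      ring
    rw [h5] at h2
    linear_combination h2 - h1

end BernoulliGeneratingFunction

/-! ### Holomorphy and poles of `quasiZeta`. -/

/-- The exponential series `∑ u_m q ^ m / (1 - q ^ m) * exp (m t)`. -/
noncomputable def lambertSeries (q : ℂ) (u : ℕ → ℂ) (t : ℂ) : ℂ :=
  ∑' m : ℕ, lambertCoeff q m * u m * Complex.exp (m * t)

theorem exists_gt_mul_exp_lt_one {x r : ℝ} (h : x * Real.exp r < 1) :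
    ∃ δ, r < δ ∧ x * Real.exp δ < 1 := by
  have hc : Filter.Tendsto (fun δ => x * Real.exp δ) (nhdsWithin r (Set.Ioi r))
      (nhds (x * Real.exp r)) :=
    ((continuous_const.mul Real.continuous_exp).tendsto r).mono_left nhdsWithin_le_nhds
  obtain ⟨δ, h1, h2⟩ := ((hc.eventually (gt_mem_nhds h)).and self_mem_nhdsWithin).exists
  exact ⟨δ, h2, h1⟩

theorem differentiableAt_lambertSeries {q : ℂ} (hq : ‖q‖ < 1) {u : ℕ → ℂ} (hu : ∀ m, ‖u m‖ ≤ 1)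
    {t : ℂ} (ht : ‖q‖ * Real.exp t.re < 1) : DifferentiableAt ℂ (lambertSeries q u) t := by
  obtain ⟨δ, h1, h2⟩ := exists_gt_mul_exp_lt_one ht
  exact (differentiableOn_expSeries (summable_lambertCoeff hq h2 hu)).differentiableAt
    ((isOpen_lt Complex.continuous_re continuous_const).mem_nhds h1)

theorem isOpen_norm_mul_exp_re_lt_one (q : ℂ) : IsOpen {t : ℂ | ‖q‖ * Real.exp t.re < 1} :=
  isOpen_lt (by fun_prop) continuous_const

theorem analyticAt_lambertSeries {q : ℂ} (hq : ‖q‖ < 1) {u : ℕ → ℂ} (hu : ∀ m, ‖u m‖ ≤ 1) :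
    AnalyticAt ℂ (lambertSeries q u) 0 := by
  have h : DifferentiableOn ℂ (lambertSeries q u) {t : ℂ | ‖q‖ * Real.exp t.re < 1} :=
    fun t ht => (differentiableAt_lambertSeries hq hu ht).differentiableWithinAt
  exact h.analyticAt ((isOpen_norm_mul_exp_re_lt_one q).mem_nhds (by simpa using hq))

theorem iteratedDeriv_lambertSeries {q : ℂ} (hq : ‖q‖ < 1) {u : ℕ → ℂ} (hu : ∀ m, ‖u m‖ ≤ 1)
    (j : ℕ) : iteratedDeriv j (lambertSeries q u) 0 =
      ∑' m : ℕ, lambertCoeff q m * u m * (m : ℂ) ^ j := by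
  obtain ⟨δ, h1, h2⟩ := exists_gt_mul_exp_lt_one (x := ‖q‖) (r := 0) (by simpa using hq)
  have := iteratedDeriv_expSeries (summable_lambertCoeff hq h2 hu) j (t := 0) (by simpa using h1)
  simpa using! this

theorem cayleyTail_exp {q : ℂ} (hq : ‖q‖ < 1) {t : ℂ} (ht : ‖q‖ * Real.exp t.re < 1) :
    cayleyTail q (Complex.exp t) = lambertSeries q 1 t := by
  rw [cayleyTail_eq_tsum hq (by rwa [norm_mul, Complex.norm_exp]), lambertSeries]
  refine tsum_congr fun m => ?_
  rw [Complex.exp_nat_mul, Pi.one_apply, mul_one]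

theorem norm_exp_mul_exp_re_lt_one {τ z : ℂ} (h : -τ.im < z.im) :
    ‖Complex.exp (2 * Real.pi * Complex.I * τ)‖ *
      Real.exp (2 * Real.pi * Complex.I * z : ℂ).re < 1 := by
  rw [norm_exp_two_pi_I_mul, ← Real.exp_add, Real.exp_lt_one_iff]
  simp only [Complex.mul_re, Complex.mul_im, Complex.re_ofNat, Complex.im_ofNat, Complex.ofReal_re,
    Complex.ofReal_im, Complex.I_re, Complex.I_im]
  nlinarith [mul_pos Real.pi_pos (by linarith : 0 < τ.im + z.im)]

theorem quasiZeta_eq_lambertSeries {τ z : ℂ} (hτ : 0 < τ.im) (h1 : -τ.im < z.im)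
    (h2 : z.im < τ.im) :
    quasiZeta τ z = -(2 * Real.pi * Complex.I) *
      (halfCayley (Complex.exp (2 * Real.pi * Complex.I * z)) +
        lambertSeries (Complex.exp (2 * Real.pi * Complex.I * τ)) 1 (2 * Real.pi * Complex.I * z) -
        lambertSeries (Complex.exp (2 * Real.pi * Complex.I * τ)) 1
          (-(2 * Real.pi * Complex.I * z))) := by
  have hq := norm_exp_two_pi_I_mul_lt_one hτ
  have h3 := norm_exp_mul_exp_re_lt_one h1
  have h4 := norm_exp_mul_exp_re_lt_one (τ := τ) (z := -z) (by simpa using h2)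
  rw [mul_neg] at h4
  rw [quasiZeta, cayleySum, cayleyTail_exp hq h3, ← Complex.exp_neg, cayleyTail_exp hq h4]

theorem differentiableAt_quasiZeta_of_strip {τ z : ℂ} (hτ : 0 < τ.im) (h1 : -τ.im < z.im)
    (h2 : z.im < τ.im) (hz : Complex.exp (2 * Real.pi * Complex.I * z) ≠ 1) :
    DifferentiableAt ℂ (quasiZeta τ) z := by
  have hq := norm_exp_two_pi_I_mul_lt_one hτ
  have hev : quasiZeta τ =ᶠ[nhds z] fun z => -(2 * Real.pi * Complex.I) *
      (halfCayley (Complex.exp (2 * Real.pi * Complex.I * z)) +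
        lambertSeries (Complex.exp (2 * Real.pi * Complex.I * τ)) 1 (2 * Real.pi * Complex.I * z) -
        lambertSeries (Complex.exp (2 * Real.pi * Complex.I * τ)) 1
          (-(2 * Real.pi * Complex.I * z))) := by
    filter_upwards [(isOpen_lt continuous_const Complex.continuous_im).mem_nhds h1,
      (isOpen_lt Complex.continuous_im continuous_const).mem_nhds h2] with y hy1 hy2
    exact quasiZeta_eq_lambertSeries hτ hy1 hy2
  refine DifferentiableAt.congr_of_eventuallyEq ?_ hev
  have hz' : 2 * (1 - Complex.exp (2 * Real.pi * Complex.I * z)) ≠ 0 :=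
    mul_ne_zero two_ne_zero (sub_ne_zero.mpr hz.symm)
  have h3 := norm_exp_mul_exp_re_lt_one h1
  have h4 := norm_exp_mul_exp_re_lt_one (τ := τ) (z := -z) (by simpa using h2)
  rw [mul_neg] at h4
  have d0 : DifferentiableAt ℂ (fun z => halfCayley (Complex.exp (2 * Real.pi * Complex.I * z))) z :=
    DifferentiableAt.div (by fun_prop) (by fun_prop) hz'
  have d1 := (differentiableAt_lambertSeries hq (u := 1) (fun _ => by simp) h3).comp z
    (f := fun z => 2 * Real.pi * Complex.I * z) (by fun_prop)
  have d2 := (differentiableAt_lambertSeries hq (u := 1) (fun _ => by simp) h4).comp z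
    (f := fun z => -(2 * Real.pi * Complex.I * z)) (by fun_prop)
  exact ((d0.add d1).sub d2).const_mul _

/-- Quasi-periodicity moves z into the strip 0 ≤ Im z < Im τ, where both Lambert series converge. -/
theorem differentiableAt_quasiZeta {τ z : ℂ} (hτ : 0 < τ.im) (hz : ∀ m n : ℤ, z ≠ m * τ + n) :
    DifferentiableAt ℂ (quasiZeta τ) z := by
  set m : ℤ := ⌊z.im / τ.im⌋ with hm
  have h1 : (m : ℝ) * τ.im ≤ z.im := (le_div_iff₀ hτ).mp (Int.floor_le _)
  have h2 : z.im < (m + 1 : ℝ) * τ.im := (div_lt_iff₀ hτ).mp (Int.lt_floor_add_one _)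
  have him : (z - m * τ).im = z.im - m * τ.im := by simp
  have hd : DifferentiableAt ℂ (quasiZeta τ) (z - m * τ) := by
    refine differentiableAt_quasiZeta_of_strip hτ (by rw [him]; linarith) (by rw [him]; linarith)
      fun h => ?_
    obtain ⟨n, hn⟩ := Complex.exp_eq_one_iff.mp h
    refine hz m n ?_
    have : z - m * τ = n := by
      refine mul_left_cancel₀ Complex.two_pi_I_ne_zero ?_
      rw [hn]; ring
    linear_combination this
  have heq : quasiZeta τ = fun y => quasiZeta τ (y - m * τ) - 2 * Real.pi * Complex.I * m := by
    funext y
    have := quasiZeta_add_int_mul hτ (y - m * τ) m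
    rwa [sub_add_cancel] at this
  rw [heq]
  exact (hd.comp z (f := fun y => y - m * τ) (by fun_prop)).sub_const _

theorem eventually_eq_zero_or_exp_ne_one :
    ∀ᶠ t : ℂ in nhds 0, t = 0 ∨ Complex.exp t ≠ 1 := by
  filter_upwards [isOpen_expSlope_ne_zero.mem_nhds zero_mem_expSlope_ne_zero] with t ht
  by_contra! h
  have := mul_expSlope t
  rw [h.2, sub_self] at this
  exact (mul_ne_zero h.1 ht) this

theorem differentiableAt_quasiZeta_sub_inv {τ : ℂ} (hτ : 0 < τ.im) :
    DifferentiableAt ℂ (fun z => quasiZeta τ z - z⁻¹) 0 := by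
  have hq := norm_exp_two_pi_I_mul_lt_one hτ
  have hmap : Filter.Tendsto (fun z : ℂ => 2 * Real.pi * Complex.I * z) (nhds 0) (nhds 0) := by
    have : Continuous fun z : ℂ => 2 * Real.pi * Complex.I * z := by fun_prop
    simpa using this.tendsto 0
  have hev : (fun z => quasiZeta τ z - z⁻¹) =ᶠ[nhds 0] fun z => -(2 * Real.pi * Complex.I) *
      (-bernoulliGenReg 0 (2 * Real.pi * Complex.I * z) - 1 / 2 +
        lambertSeries (Complex.exp (2 * Real.pi * Complex.I * τ)) 1 (2 * Real.pi * Complex.I * z) -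
        lambertSeries (Complex.exp (2 * Real.pi * Complex.I * τ)) 1
          (-(2 * Real.pi * Complex.I * z))) := by
    filter_upwards [(isOpen_lt continuous_const Complex.continuous_im).mem_nhds
        (show (0 : ℂ) ∈ {z : ℂ | -τ.im < z.im} by simpa using hτ),
      (isOpen_lt Complex.continuous_im continuous_const).mem_nhds
        (show (0 : ℂ) ∈ {z : ℂ | z.im < τ.im} by simpa using hτ),
      hmap.eventually eventually_eq_zero_or_exp_ne_one] with y hy1 hy2 hy3
    rw [quasiZeta_eq_lambertSeries hτ hy1 hy2, ← halfCayley_exp hy3, mul_inv]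
    have := Complex.two_pi_I_ne_zero
    field_simp
    ring
  refine DifferentiableAt.congr_of_eventuallyEq ?_ hev
  have hcomp : ∀ {g h : ℂ → ℂ}, DifferentiableAt ℂ g 0 → Differentiable ℂ h → h 0 = 0 →
      DifferentiableAt ℂ (fun z => g (h z)) 0 := fun {g h} hg hh h0 =>
    DifferentiableAt.comp (0 : ℂ) (f := h) (by rwa [h0]) (hh 0)
  have hL : DifferentiableAt ℂ (lambertSeries (Complex.exp (2 * Real.pi * Complex.I * τ)) 1) 0 :=
    (analyticAt_lambertSeries hq (u := 1) (fun _ => by simp)).differentiableAt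
  have d0 := hcomp (h := fun z => 2 * Real.pi * Complex.I * z)
    (analyticAt_bernoulliGenReg 0).differentiableAt (by fun_prop) (by simp)
  have d1 := hcomp (h := fun z => 2 * Real.pi * Complex.I * z) hL (by fun_prop) (by simp)
  have d2 := hcomp (h := fun z => -(2 * Real.pi * Complex.I * z)) hL (by fun_prop) (by simp)
  exact (((d0.neg.sub_const _).add d1).sub d2).const_mul _

/-! ### Modular transformation by Liouville's theorem. -/

theorem linearIndependent_self_one {τ : ℂ} (hτ : 0 < τ.im) : LinearIndependent ℝ ![τ, 1] := by
  rw [LinearIndependent.pair_iff]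
  intro s t h
  have him := congrArg Complex.im h
  simp at him
  have hs : s = 0 := him.resolve_right hτ.ne'
  subst hs
  simpa using h

/-- An entire function with periods `τ` and `1` is constant. -/
theorem apply_eq_apply_of_doubly_periodic {τ : ℂ} (hτ : 0 < τ.im) {f : ℂ → ℂ}
    (hf : Differentiable ℂ f) (hper : ∀ z : ℂ, ∀ m n : ℤ, f (z + (m * τ + n)) = f z) (z w : ℂ) :
    f z = f w := by
  let L : PeriodPair := ⟨τ, 1, linearIndependent_self_one hτ⟩
  refine hf.apply_eq_apply_of_bounded (IsZLattice.isCompact_range_of_periodic L.lattice f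
    hf.continuous fun z w hw => ?_).isBounded z w
  obtain ⟨m, n, rfl⟩ := PeriodPair.mem_lattice.mp hw
  simpa [L] using hper z m n

/-- The behaviour of `quasiZeta` under a modular transformation. -/
theorem quasiZeta_div {τ τ' : ℂ} (hτ : 0 < τ.im) (hτ' : 0 < τ'.im) {a b c d : ℤ}
    (hdet : a * d - b * c = 1) (hj : (c : ℂ) * τ + d ≠ 0) (h : τ' * (c * τ + d) = a * τ + b)
    (z : ℂ) : quasiZeta τ' (z / (c * τ + d)) =
      (c * τ + d) * quasiZeta τ z + 2 * Real.pi * Complex.I * c * z := by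
  set j : ℂ := c * τ + d with hjdef
  have hdet' : (a : ℂ) * d - b * c = 1 := by exact_mod_cast hdet
  have hdiv : ∀ m n : ℤ, ((m : ℂ) * τ + n) / j =
      ((m * d - n * c : ℤ) : ℂ) * τ' + ((n * a - m * b : ℤ) : ℂ) := by
    intro m n
    rw [div_eq_iff hj]
    push_cast
    rw [hjdef] at h ⊢
    linear_combination (-(m * d - n * c : ℂ)) * h - (m * τ + n : ℂ) * hdet'
  -- The linear term is chosen to cancel the quasi-periods, so f is doubly periodic; it will be
  -- shown entire, hence constant.
  set f : ℂ → ℂ := fun z => quasiZeta τ' (z / j) / j - quasiZeta τ z -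
    2 * Real.pi * Complex.I * c * z / j with hf
  have hper : ∀ z : ℂ, ∀ m n : ℤ, f (z + (m * τ + n)) = f z := by
    intro z m n
    simp only [hf]
    rw [add_div, hdiv, quasiZeta_add_lattice hτ', quasiZeta_add_lattice hτ]
    push_cast
    field_simp
    rw [hjdef]
    ring
  have hf0 : DifferentiableAt ℂ f 0 := by
    have h1 := differentiableAt_quasiZeta_sub_inv hτ
    have h2 : DifferentiableAt ℂ (fun z => quasiZeta τ' (z / j) - (z / j)⁻¹) 0 :=
      DifferentiableAt.comp (0 : ℂ) (f := fun z => z / j)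
        (by simpa using differentiableAt_quasiZeta_sub_inv hτ') (by fun_prop)
    -- The principal parts at 0 agree, since (z/j)⁻¹/j = z⁻¹, also at z = 0 with 0⁻¹ = 0.
    have heq : f = fun z => (quasiZeta τ' (z / j) - (z / j)⁻¹) / j - (quasiZeta τ z - z⁻¹) -
        2 * Real.pi * Complex.I * c * z / j := by
      funext z
      simp only [hf, inv_div]
      field_simp
      ring
    rw [heq]
    exact ((h2.div_const _).sub h1).sub (by fun_prop)
  have hdiff : Differentiable ℂ f := by
    intro z
    by_cases hz : ∃ m n : ℤ, z = m * τ + n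
    · obtain ⟨m, n, rfl⟩ := hz
      have heq : f = fun y => f (y - (m * τ + n)) := by
        funext y
        have := hper (y - (m * τ + n)) m n
        rwa [sub_add_cancel] at this
      rw [heq]
      exact DifferentiableAt.comp (m * τ + n : ℂ) (f := fun y => y - (m * τ + n))
        (by simpa using hf0) (by fun_prop)
    · push Not at hz
      have h1 := differentiableAt_quasiZeta hτ hz
      have h2 : DifferentiableAt ℂ (quasiZeta τ') (z / j) := by
        refine differentiableAt_quasiZeta hτ' fun m n hmn => hz (m * a + n * c) (m * b + n * d) ?_
        rw [div_eq_iff hj] at hmn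
        rw [hmn, hjdef]
        rw [hjdef] at h
        push_cast
        linear_combination (m : ℂ) * h
      have h3 : DifferentiableAt ℂ (fun z => quasiZeta τ' (z / j)) z :=
        DifferentiableAt.comp z (f := fun z => z / j) h2 (by fun_prop)
      exact ((h3.div_const _).sub h1).sub (by fun_prop)
  -- Oddness makes the constant value f(0) equal to 0.
  have hzero : ∀ τ : ℂ, quasiZeta τ 0 = 0 := fun τ => by
    have := quasiZeta_neg τ 0
    rw [neg_zero] at this
    linear_combination this / 2
  have hconst := apply_eq_apply_of_doubly_periodic hτ hdiff hper z 0
  simp only [hf, zero_div, hzero, mul_zero, sub_zero] at hconst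
  field_simp at hconst
  linear_combination hconst

/-! ### Twisting by a Dirichlet character. -/

theorem halfCayley_eq_sum {N : ℕ} {x : ℂ} (hx : x ^ N ≠ 1) :
    halfCayley x = 1 / 2 + ∑ a ∈ Finset.Icc 1 N, x ^ a / (1 - x ^ N) := by
  have h1 : x ≠ 1 := by rintro rfl; simp at hx
  have h2 : ∑ a ∈ Finset.Icc 1 N, x ^ a = x * ∑ a ∈ Finset.range N, x ^ a := by
    have h : Finset.Icc 1 N = Finset.Ico (0 + 1) (N + 1) := by ext; simp
    rw [h, ← Finset.sum_Ico_add' (fun a => x ^ a) 0 N 1, Finset.range_eq_Ico, Finset.mul_sum]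
    exact Finset.sum_congr rfl fun a _ => pow_succ' x a
  have h3 := mul_neg_geom_sum x N
  have h4 : 1 - x ≠ 0 := sub_ne_zero.mpr h1.symm
  have h5 : 1 - x ^ N ≠ 0 := sub_ne_zero.mpr hx.symm
  have h6 := halfCayley_sub_half h1
  rw [← Finset.sum_div, h2]
  rw [sub_eq_iff_eq_add] at h6
  rw [h6, add_comm, add_right_inj, div_eq_div_iff h4 h5, ← h3]
  ring

/-- The function with Taylor coefficients the twisted Eisenstein series of nome `q`. -/
noncomputable def twistedGen {N : ℕ} (χ : DirichletCharacter ℂ N) (q t : ℂ) : ℂ :=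
  χ 0 / 2 - ∑ a ∈ Finset.Icc 1 N, χ (a : ZMod N) * bernoulliGenReg ((a : ℂ) / N) (N * t) +
    lambertSeries q (fun m => χ (m : ZMod N)) t -
    lambertSeries q (fun m => χ (-(m : ZMod N))) (-t)

theorem analyticAt_twistedGen {N : ℕ} (χ : DirichletCharacter ℂ N) {q : ℂ} (hq : ‖q‖ < 1) :
    AnalyticAt ℂ (twistedGen χ q) 0 := by
  have hB : ∀ x : ℂ, AnalyticAt ℂ (fun t => bernoulliGenReg x (N * t)) 0 := fun x =>
    AnalyticAt.fun_comp (f := fun t : ℂ => (N : ℂ) * t)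
      (by simpa using analyticAt_bernoulliGenReg x) (by fun_prop)
  have hL : AnalyticAt ℂ (fun t => lambertSeries q (fun m => χ (-(m : ZMod N))) (-t)) 0 :=
    AnalyticAt.fun_comp (f := fun t : ℂ => -t)
      (by simpa using analyticAt_lambertSeries hq fun m => χ.norm_le_one _) (by fun_prop)
  exact ((analyticAt_const.sub (Finset.analyticAt_fun_sum _ fun a _ =>
    analyticAt_const.mul (hB _))).add (analyticAt_lambertSeries hq fun m => χ.norm_le_one _)).sub hL

section TwistedZeta

variable {N : ℕ} [NeZero N] (χ : DirichletCharacter ℂ N)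

/-- The finite Fourier coefficients of a Dirichlet character. -/
noncomputable def charTransform (b : ZMod N) : ℂ := (N : ℂ)⁻¹ * ZMod.dft χ b

theorem sum_charTransform_mul_stdAddChar (m : ZMod N) :
    ∑ b, charTransform χ b * ZMod.stdAddChar (b * m) = χ m := by
  have h := congrFun (ZMod.dft_dft (χ : ZMod N → ℂ)) (-m)
  rw [ZMod.dft_apply] at h
  simp only [mul_neg, neg_neg, smul_eq_mul] at h
  have hN : (N : ℂ) ≠ 0 := NeZero.ne _
  simp only [charTransform]
  rw [← mul_right_inj' hN, ← h, Finset.mul_sum]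
  refine Finset.sum_congr rfl fun b _ => ?_
  field_simp

theorem sum_charTransform : ∑ b, charTransform χ b = χ 0 := by
  rw [← sum_charTransform_mul_stdAddChar χ 0]
  simp

/-- Only a unit substitution in the Fourier sum and multiplicativity of χ are used, so χ may be
imprimitive. -/
theorem charTransform_eq_mul_unit (u : (ZMod N)ˣ) (b : ZMod N) :
    charTransform χ b = χ u * charTransform χ (u * b) := by
  have h := ZMod.dft_comp_unitMul (χ : ZMod N → ℂ) u (u * b)
  simp only [map_mul] at h
  rw [ZMod.dft_const_mul, ← mul_assoc, Units.inv_mul, one_mul] at h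
  rw [charTransform, charTransform, ← h]
  ring

theorem charTransform_zero : charTransform χ 0 = (N : ℂ)⁻¹ * ∑ a, χ a := by
  rw [charTransform, ZMod.dft_apply_zero]

theorem stdAddChar_eq_exp (b : ZMod N) (m : ℤ) :
    ZMod.stdAddChar (b * (m : ZMod N)) =
      Complex.exp (2 * Real.pi * Complex.I * (m * ((b.val : ℂ) / N))) := by
  have h := ZMod.stdAddChar_coe (N := N) (b.val * m : ℤ)
  push_cast at h
  rw [ZMod.natCast_zmod_val] at h
  rw [h]
  congr 1
  ring

/-- The combination of translates of `quasiZeta` by `N`-torsion points defined by a Dirichlet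
character. -/
noncomputable def twistedZeta (τ z : ℂ) : ℂ :=
  ∑ b : ZMod N, charTransform χ b * quasiZeta τ (z + (b.val : ℂ) / N)

theorem quasiZeta_add_int_div_eq {τ : ℂ} (z : ℂ) (x : ℤ) :
    quasiZeta τ (z + (x : ℂ) / N) = quasiZeta τ (z + ((x : ZMod N).val : ℂ) / N) := by
  have hN : (N : ℂ) ≠ 0 := NeZero.ne _
  have h : (x : ℂ) = (x : ZMod N).val + N * (x / N : ℤ) := by
    have h1 : ((x : ZMod N).val : ℤ) = x % N := ZMod.val_intCast x
    have h2 : x = (x : ZMod N).val + N * (x / N : ℤ) := by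
      rw [h1]; exact (Int.emod_add_mul_ediv x N).symm
    exact_mod_cast congrArg (Int.cast : ℤ → ℂ) h2
  have h2 : z + (x : ℂ) / N = z + ((x : ZMod N).val : ℂ) / N + (x / N : ℤ) := by
    rw [h]
    field_simp
    rw [add_assoc]
  rw [h2, quasiZeta_add_int]

/-- The behaviour of `twistedZeta` under `Γ₀(N)`. -/
theorem twistedZeta_div {τ τ' : ℂ} (hτ : 0 < τ.im) (hτ' : 0 < τ'.im) {a b c d : ℤ}
    (hdet : a * d - b * c = 1) (hc : (N : ℤ) ∣ c) (hj : (c : ℂ) * τ + d ≠ 0)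
    (h : τ' * (c * τ + d) = a * τ + b) (z : ℂ) :
    twistedZeta χ τ' (z / (c * τ + d)) =
      (c * τ + d) * χ (d : ZMod N) * twistedZeta χ τ z +
        2 * Real.pi * Complex.I * c * z * χ 0 := by
  have hN : (N : ℂ) ≠ 0 := NeZero.ne _
  obtain ⟨e, rfl⟩ := hc
  -- With c = Ne one has (cτ + d) x/N = exτ + dx/N, so the torsion point moves to dx/N up to a
  -- lattice point. The quasi-period of exτ cancels the x-dependent part of the linear term of
  -- `quasiZeta_div`.
  have hterm : ∀ x : ZMod N, quasiZeta τ' (z / (((N * e : ℤ) : ℂ) * τ + d) + (x.val : ℂ) / N) =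
      (((N * e : ℤ) : ℂ) * τ + d) * quasiZeta τ (z + (((d : ZMod N) * x).val : ℂ) / N) +
        2 * Real.pi * Complex.I * (N * e : ℤ) * z := by
    intro x
    have h1 := quasiZeta_div hτ hτ' hdet hj h
      (z + (((N * e : ℤ) : ℂ) * τ + d) * ((x.val : ℂ) / N))
    rw [add_div, mul_div_cancel_left₀ _ hj] at h1
    have h2 := quasiZeta_add_int_mul hτ (z + ((d * x.val : ℤ) : ℂ) / N) (e * x.val)
    rw [quasiZeta_add_int_div_eq] at h2
    have h3 : z + ((d * x.val : ℤ) : ℂ) / N + ((e * x.val : ℤ) : ℂ) * τ =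
        z + (((N * e : ℤ) : ℂ) * τ + d) * ((x.val : ℂ) / N) := by
      push_cast
      field_simp
      ring
    have h4 : ((d * x.val : ℤ) : ZMod N) = (d : ZMod N) * x := by
      push_cast
      rw [ZMod.natCast_zmod_val]
    rw [h3, h4] at h2
    rw [h1, h2]
    push_cast
    field_simp
    ring
  have hd : IsUnit (d : ZMod N) := by
    have h1 := congrArg (Int.cast : ℤ → ZMod N) hdet
    push_cast at h1
    rw [ZMod.natCast_self, zero_mul, mul_zero, sub_zero] at h1
    exact IsUnit.of_mul_eq_one_right _ h1
  obtain ⟨u, hu⟩ := hd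
  rw [twistedZeta, Finset.sum_congr rfl fun x _ => by rw [hterm x]]
  simp only [mul_add, Finset.sum_add_distrib]
  rw [← Finset.sum_mul, sum_charTransform, twistedZeta, Finset.mul_sum]
  congr 1
  · refine Fintype.sum_equiv u.mulLeft _ _ fun x => ?_
    rw [charTransform_eq_mul_unit χ u x, Units.mulLeft_apply, hu]
    ring
  · ring

/-- The zero class is represented by N rather than 0, matching the range in `generalizedBernoulli`.
-/
theorem sum_Icc_natCast_zmod (f : ZMod N → ℂ) :
    ∑ a ∈ Finset.Icc 1 N, f (a : ZMod N) = ∑ x, f x := by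
  have hN : 0 < N := NeZero.pos N
  refine Finset.sum_nbij' (fun a => (a : ZMod N)) (fun x => if x.val = 0 then N else x.val)
    (fun _ _ => Finset.mem_univ _) (fun x _ => ?_) (fun a ha => ?_) (fun x _ => ?_) (fun _ _ => rfl)
  · have := x.val_lt
    rw [Finset.mem_Icc]
    split_ifs <;> omega
  · rw [Finset.mem_Icc] at ha
    rw [ZMod.val_natCast]
    rcases eq_or_lt_of_le ha.2 with h | h
    · simp [h]
    · rw [Nat.mod_eq_of_lt h, if_neg (by omega)]
  · split_ifs with h
    · rw [ZMod.natCast_self]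
      exact ((ZMod.val_eq_zero x).mp h).symm
    · exact ZMod.natCast_zmod_val x

/-- The N arguments x all satisfy x^N = e^(Nt), so `halfCayley_eq_sum` gives a common denominator;
Fourier inversion then turns the powers of roots of unity into χ(a), and the poles 1/(Nt) add up to
the last term. -/
theorem sum_charTransform_mul_halfCayley {t : ℂ} (ht : Complex.exp (N * t) ≠ 1) :
    ∑ b : ZMod N, charTransform χ b *
        halfCayley (Complex.exp (t + 2 * Real.pi * Complex.I * ((b.val : ℂ) / N))) =
      χ 0 / 2 - ∑ a ∈ Finset.Icc 1 N, χ (a : ZMod N) * bernoulliGenReg ((a : ℂ) / N) (N * t) -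
        charTransform χ 0 / t := by
  have hN : (N : ℂ) ≠ 0 := NeZero.ne _
  have hpow : ∀ (b : ZMod N) (m : ℕ),
      Complex.exp (t + 2 * Real.pi * Complex.I * ((b.val : ℂ) / N)) ^ m =
        ZMod.stdAddChar (b * (m : ZMod N)) * Complex.exp (m * t) := fun b m => by
    rw [← Int.cast_natCast (R := ZMod N), stdAddChar_eq_exp, ← Complex.exp_nat_mul,
      ← Complex.exp_add]
    congr 1
    push_cast
    ring
  have hpowN : ∀ b : ZMod N,
      Complex.exp (t + 2 * Real.pi * Complex.I * ((b.val : ℂ) / N)) ^ N = Complex.exp (N * t) :=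
    fun b => by rw [hpow, ZMod.natCast_self]; simp
  have h1 : ∀ b : ZMod N,
      halfCayley (Complex.exp (t + 2 * Real.pi * Complex.I * ((b.val : ℂ) / N))) =
      1 / 2 + ∑ a ∈ Finset.Icc 1 N, ZMod.stdAddChar (b * (a : ZMod N)) *
        (Complex.exp (a * t) / (1 - Complex.exp (N * t))) := fun b => by
    rw [halfCayley_eq_sum (N := N) (by rwa [hpowN]), hpowN]
    simp only [hpow, mul_div_assoc]
  simp only [h1, mul_add, Finset.sum_add_distrib, Finset.mul_sum]
  rw [Finset.sum_comm, ← Finset.sum_mul, sum_charTransform]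
  have h2 : ∀ a ∈ Finset.Icc 1 N, ∑ b : ZMod N, charTransform χ b *
      (ZMod.stdAddChar (b * (a : ZMod N)) * (Complex.exp (a * t) / (1 - Complex.exp (N * t)))) =
      -(χ (a : ZMod N) * bernoulliGenReg ((a : ℂ) / N) (N * t)) -
        χ (a : ZMod N) * (N * t)⁻¹ := fun a _ => by
    have h3 := exp_div_exp_sub_one ((a : ℂ) / N) ht
    have h4 : (a : ℂ) / N * (N * t) = a * t := by field_simp
    rw [h4] at h3
    have h5 : Complex.exp (a * t) / (1 - Complex.exp (N * t)) =
        -((N * t)⁻¹ + bernoulliGenReg ((a : ℂ) / N) (N * t)) := by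
      rw [← h3, ← div_neg, neg_sub]
    simp only [← mul_assoc]
    rw [← Finset.sum_mul, sum_charTransform_mul_stdAddChar, h5]
    ring
  rw [Finset.sum_congr rfl h2, Finset.sum_sub_distrib, Finset.sum_neg_distrib, ← Finset.sum_mul,
    sum_Icc_natCast_zmod (fun x => χ x), charTransform_zero, mul_inv]
  ring

theorem sum_charTransform_mul_lambertSeries {q t : ℂ} (hq : ‖q‖ < 1)
    (ht : ‖q‖ * Real.exp t.re < 1) (ε : ℤ) :
    ∑ b : ZMod N, charTransform χ b *
        lambertSeries q 1 (t + ε * (2 * Real.pi * Complex.I * ((b.val : ℂ) / N))) =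
      lambertSeries q (fun m => χ ((ε * m : ℤ) : ZMod N)) t := by
  have hre : ∀ b : ZMod N,
      (t + ε * (2 * Real.pi * Complex.I * ((b.val : ℂ) / N))).re = t.re := by
    intro b
    have : (ε * (2 * Real.pi * Complex.I * ((b.val : ℂ) / N))) =
        ((ε * (2 * Real.pi * (b.val / N)) : ℝ) : ℂ) * Complex.I := by push_cast; ring
    rw [this, Complex.add_re, Complex.re_ofReal_mul]
    simp
  have hs : ∀ y : ℂ, y.re = t.re → Summable fun m : ℕ =>
      lambertCoeff q m * (1 : ℕ → ℂ) m * Complex.exp (m * y) := by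
    intro y hy
    have := summable_lambertCoeff hq ht (u := 1) (fun _ => by simp) 0
    refine Summable.of_norm ?_
    refine this.congr fun m => ?_
    rw [norm_mul _ (Complex.exp _), Complex.norm_exp, pow_zero, mul_one]
    simp [hy]
  simp only [lambertSeries, ← tsum_mul_left]
  rw [← Summable.tsum_finsetSum fun b _ => (hs _ (hre b)).mul_left _]
  refine tsum_congr fun m => ?_
  rw [← sum_charTransform_mul_stdAddChar χ, Finset.mul_sum, Finset.sum_mul]
  refine Finset.sum_congr rfl fun b _ => ?_
  rw [stdAddChar_eq_exp, Pi.one_apply, mul_add, Complex.exp_add,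
    show (m : ℂ) * (ε * (2 * Real.pi * Complex.I * ((b.val : ℂ) / N))) =
      2 * Real.pi * Complex.I * (((ε * m : ℤ) : ℂ) * ((b.val : ℂ) / N)) by push_cast; ring]
  ring

theorem twistedZeta_eq_twistedGen {τ t : ℂ} (hτ : 0 < τ.im)
    (h1 : ‖Complex.exp (2 * Real.pi * Complex.I * τ)‖ * Real.exp t.re < 1)
    (h2 : ‖Complex.exp (2 * Real.pi * Complex.I * τ)‖ * Real.exp (-t).re < 1)
    (ht : Complex.exp (N * t) ≠ 1) :
    twistedZeta χ τ (t / (2 * Real.pi * Complex.I)) = -(2 * Real.pi * Complex.I) *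
      (twistedGen χ (Complex.exp (2 * Real.pi * Complex.I * τ)) t - charTransform χ 0 / t) := by
  have hq := norm_exp_two_pi_I_mul_lt_one hτ
  set q := Complex.exp (2 * Real.pi * Complex.I * τ) with hqdef
  have hπ := Complex.two_pi_I_ne_zero
  have harg : ∀ b : ZMod N, 2 * Real.pi * Complex.I *
      (t / (2 * Real.pi * Complex.I) + (b.val : ℂ) / N) =
      t + 2 * Real.pi * Complex.I * ((b.val : ℂ) / N) := fun b => by
    rw [mul_add, mul_div_cancel₀ _ hπ]
  have hre : ∀ b : ZMod N, (t + 2 * Real.pi * Complex.I * ((b.val : ℂ) / N)).re = t.re := by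
    intro b
    have : (2 * Real.pi * Complex.I * ((b.val : ℂ) / N)) =
        ((2 * Real.pi * (b.val / N) : ℝ) : ℂ) * Complex.I := by push_cast; ring
    rw [this, Complex.add_re, Complex.re_ofReal_mul]
    simp
  have hterm : ∀ b : ZMod N, quasiZeta τ (t / (2 * Real.pi * Complex.I) + (b.val : ℂ) / N) =
      -(2 * Real.pi * Complex.I) *
        (halfCayley (Complex.exp (t + 2 * Real.pi * Complex.I * ((b.val : ℂ) / N))) +
        lambertSeries q 1 (t + (1 : ℤ) * (2 * Real.pi * Complex.I * ((b.val : ℂ) / N))) -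
        lambertSeries q 1 (-t + (-1 : ℤ) * (2 * Real.pi * Complex.I * ((b.val : ℂ) / N)))) := by
    intro b
    rw [quasiZeta, harg, ← hqdef, cayleySum, ← Complex.exp_neg,
      cayleyTail_exp hq (by rwa [hre]), cayleyTail_exp hq (by rwa [Complex.neg_re, hre])]
    push_cast
    rw [one_mul, neg_one_mul, neg_add]
  rw [twistedZeta, Finset.sum_congr rfl fun b _ => by rw [hterm b]]
  simp only [mul_left_comm _ (-(2 * Real.pi * Complex.I)), ← Finset.mul_sum, mul_add, mul_sub,
    Finset.sum_add_distrib, Finset.sum_sub_distrib]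
  rw [sum_charTransform_mul_halfCayley χ ht, sum_charTransform_mul_lambertSeries χ hq h1,
    sum_charTransform_mul_lambertSeries χ hq h2, twistedGen]
  push_cast
  simp only [one_mul, neg_one_mul]
  ring

/-- The behaviour of the generating function of the twisted Eisenstein series under `Γ₀(N)`. -/
theorem twistedGen_div {τ τ' : ℂ} (hτ : 0 < τ.im) (hτ' : 0 < τ'.im) {a b c d : ℤ}
    (hdet : a * d - b * c = 1) (hc : (N : ℤ) ∣ c) (hj : (c : ℂ) * τ + d ≠ 0)
    (h : τ' * (c * τ + d) = a * τ + b) :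
    (fun t => twistedGen χ (Complex.exp (2 * Real.pi * Complex.I * τ')) ((c * τ + d)⁻¹ * t))
      =ᶠ[nhds 0] fun t => (c * τ + d) * χ (d : ZMod N) *
        twistedGen χ (Complex.exp (2 * Real.pi * Complex.I * τ)) t -
          c * χ 0 / (2 * Real.pi * Complex.I) * t := by
  set j : ℂ := c * τ + d with hjdef
  set q := Complex.exp (2 * Real.pi * Complex.I * τ) with hqdef
  set q' := Complex.exp (2 * Real.pi * Complex.I * τ') with hqdef'
  have hq : ‖q‖ < 1 := norm_exp_two_pi_I_mul_lt_one hτ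
  have hq' : ‖q'‖ < 1 := norm_exp_two_pi_I_mul_lt_one hτ'
  have hN : (N : ℂ) ≠ 0 := NeZero.ne _
  have hlin : ∀ k : ℂ, Filter.Tendsto (fun t : ℂ => k * t) (nhds 0) (nhds 0) := fun k => by
    have : Continuous fun t : ℂ => k * t := by fun_prop
    simpa using this.tendsto 0
  have hnorm : ∀ {p : ℂ}, ‖p‖ < 1 → ∀ᶠ t : ℂ in nhds 0, ‖p‖ * Real.exp t.re < 1 := fun {p} hp =>
    (isOpen_norm_mul_exp_re_lt_one p).mem_nhds (by simpa using hp)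
  have hA : AnalyticAt ℂ (fun t => twistedGen χ q' (j⁻¹ * t)) 0 :=
    AnalyticAt.fun_comp (f := fun t : ℂ => j⁻¹ * t)
      (by simpa using analyticAt_twistedGen χ hq') (by fun_prop)
  have hB : AnalyticAt ℂ (fun t => j * χ (d : ZMod N) * twistedGen χ q t -
      c * χ 0 / (2 * Real.pi * Complex.I) * t) 0 :=
    (analyticAt_const.mul (analyticAt_twistedGen χ hq)).sub (analyticAt_const.mul analyticAt_id)
  -- Both sides are continuous at 0, so t ≠ 0 may be assumed; there `twistedZeta_div` applies.
  refine (hA.continuousAt.eventuallyEq_nhds_iff_eventuallyEq_nhdsNE hB.continuousAt).mp ?_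
  have hneg : Filter.Tendsto (fun t : ℂ => -t) (nhds 0) (nhds 0) := by simpa using hlin (-1)
  filter_upwards [nhdsWithin_le_nhds (hnorm hq), nhdsWithin_le_nhds (hneg.eventually (hnorm hq)),
    nhdsWithin_le_nhds ((hlin j⁻¹).eventually (hnorm hq')),
    nhdsWithin_le_nhds ((hlin j⁻¹).eventually (hneg.eventually (hnorm hq'))),
    nhdsWithin_le_nhds ((hlin N).eventually eventually_eq_zero_or_exp_ne_one),
    nhdsWithin_le_nhds ((hlin j⁻¹).eventually ((hlin N).eventually
      eventually_eq_zero_or_exp_ne_one)), self_mem_nhdsWithin] with t h1 h2 h3 h4 h5 h6 ht0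
  have ht : t ≠ 0 := ht0
  have h5' := h5.resolve_left (mul_ne_zero hN ht)
  have h6' := h6.resolve_left (mul_ne_zero hN (mul_ne_zero (inv_ne_zero hj) ht))
  have key := twistedZeta_div χ hτ hτ' hdet hc hj h (t / (2 * Real.pi * Complex.I))
  have harg : t / (2 * Real.pi * Complex.I) / (c * τ + d) =
      (j⁻¹ * t) / (2 * Real.pi * Complex.I) := by
    rw [← hjdef]; field_simp
  rw [harg, twistedZeta_eq_twistedGen χ hτ' h3 h4 h6', twistedZeta_eq_twistedGen χ hτ h1 h2 h5',
    ← hjdef, ← hqdef, ← hqdef'] at key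
  have hd : IsUnit (d : ZMod N) := by
    obtain ⟨e, rfl⟩ := hc
    have h1 := congrArg (Int.cast : ℤ → ZMod N) hdet
    push_cast at h1
    rw [ZMod.natCast_self, zero_mul, mul_zero, sub_zero] at h1
    exact IsUnit.of_mul_eq_one_right _ h1
  obtain ⟨u, hu⟩ := hd
  have h0 := charTransform_eq_mul_unit χ u 0
  rw [mul_zero, hu] at h0
  have hπ := Complex.two_pi_I_ne_zero
  -- The polar parts transform by the same factor, because the Fourier coefficient at 0 is fixed
  -- under multiplication by χ(d).
  have e1 : charTransform χ 0 / (j⁻¹ * t) = j * χ (d : ZMod N) * (charTransform χ 0 / t) := by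
    conv_lhs => rw [h0]
    field_simp
  rw [e1] at key
  refine mul_left_cancel₀ (neg_ne_zero.mpr hπ) ?_
  have e2 : -(2 * Real.pi * Complex.I) * (c * χ 0 / (2 * Real.pi * Complex.I) * t) =
      -(c * χ 0 * t) := by field_simp
  have e3 : 2 * Real.pi * Complex.I * c * (t / (2 * Real.pi * Complex.I)) * χ 0 = c * χ 0 * t := by
    field_simp
  rw [e3] at key
  rw [mul_sub, e2]
  linear_combination key

end TwistedZeta

/-! ### Twisted Eisenstein series as Taylor coefficients. -/

theorem iteratedDeriv_comp_mul_left_zero (f : ℂ → ℂ) (k : ℂ) (n : ℕ) :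
    iteratedDeriv n (fun t => f (k * t)) 0 = k ^ n * iteratedDeriv n f 0 := by
  have h : ∀ n : ℕ, iteratedDeriv n (fun t => f (k * t)) =
      fun t => k ^ n * iteratedDeriv n f (k * t) := by
    intro n
    induction n with
    | zero => simp
    | succ n ih =>
      rw [iteratedDeriv_succ, ih]
      funext t
      rw [deriv_const_mul_field, deriv_comp_mul_left, iteratedDeriv_succ, smul_eq_mul]
      ring
  rw [h]
  simp

theorem norm_twistedSigma_le (s : ℕ) {N : ℕ} (χ : DirichletCharacter ℂ N) (n : ℕ) :
    ‖twistedSigma s χ n‖ ≤ (n : ℝ) ^ (s + 1) := by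
  rw [twistedSigma]
  calc _ ≤ ∑ d ∈ n.divisors, ‖χ (d : ZMod N) * (d : ℂ) ^ s‖ := norm_sum_le _ _
    _ ≤ ∑ d ∈ n.divisors, (n : ℝ) ^ s := by
        refine Finset.sum_le_sum fun d hd => ?_
        rw [norm_mul, norm_pow, Complex.norm_natCast]
        refine (mul_le_of_le_one_left (by positivity) (χ.norm_le_one _)).trans ?_
        gcongr
        exact Nat.divisor_le hd
    _ = n.divisors.card * (n : ℝ) ^ s := by rw [Finset.sum_const, nsmul_eq_mul]
    _ ≤ n * (n : ℝ) ^ s := by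
        gcongr
        exact Nat.card_divisors_le_self n
    _ = (n : ℝ) ^ (s + 1) := by ring

theorem summable_norm_twistedSigma (s : ℕ) {N : ℕ} (χ : DirichletCharacter ℂ N) {q : ℂ}
    (hq : ‖q‖ < 1) : Summable fun n : ℕ => ‖twistedSigma s χ n * q ^ n‖ := by
  refine Summable.of_nonneg_of_le (fun _ => norm_nonneg _) (fun n => ?_)
    (summable_norm_pow_mul_geometric_of_norm_lt_one (s + 1) hq)
  rw [norm_mul, norm_mul, norm_pow (n : ℂ), Complex.norm_natCast]
  gcongr
  exact norm_twistedSigma_le s χ n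

/-- The Lambert series of a twisted divisor sum. -/
theorem tsum_lambertCoeff_mul (s : ℕ) {N : ℕ} (χ : DirichletCharacter ℂ N) {q : ℂ}
    (hq : ‖q‖ < 1) :
    ∑' m : ℕ, lambertCoeff q m * χ (m : ZMod N) * (m : ℂ) ^ s =
      ∑' n : ℕ, twistedSigma s χ n * q ^ n := by
  -- For fixed c.2 the sum over c.1 is geometric and gives the Lambert coefficient; grouping by the
  -- product c.1 * c.2 gives the divisor sums.
  let F : ℕ+ × ℕ+ → ℂ := fun c => χ ((c.2 : ℕ) : ZMod N) * (c.2 : ℂ) ^ s * q ^ (c.1 * c.2 : ℕ)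
  have hF : Summable F := by
    refine Summable.of_norm_bounded (summable_prod_mul_pow s hq).norm fun c => ?_
    simp only [F, norm_mul]
    gcongr
    exact mul_le_of_le_one_left (norm_nonneg _) (χ.norm_le_one _)
  have h1 : ∑' c, F c = ∑' m : ℕ+, lambertCoeff q m * χ ((m : ℕ) : ZMod N) * (m : ℂ) ^ s := by
    have hF' := (Equiv.prodComm ℕ+ ℕ+).summable_iff.mpr hF
    refine ((Equiv.prodComm ℕ+ ℕ+).tsum_eq F).symm.trans (hF'.tsum_prod.trans ?_)
    refine tsum_congr fun m => ?_
    have hm : ‖q ^ (m : ℕ)‖ < 1 := by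
      rw [norm_pow]; exact pow_lt_one₀ (norm_nonneg _) hq m.ne_zero
    simp only [F, Function.comp_apply, Equiv.prodComm_apply, Prod.swap_prod_mk]
    rw [tsum_mul_left, tsum_pnat_eq_tsum_succ (f := fun n => q ^ (n * m : ℕ)), lambertCoeff,
      ← tsum_pow_succ_of_norm_lt_one hm]
    simp only [mul_comm _ (m : ℕ), pow_mul]
    ring
  have h2 : ∑' c, F c = ∑' n : ℕ+, twistedSigma s χ n * q ^ (n : ℕ) := by
    have hF' := sigmaAntidiagonalEquivProd.summable_iff.mpr hF
    refine (sigmaAntidiagonalEquivProd.tsum_eq F).symm.trans (hF'.tsum_sigma.trans ?_)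
    refine tsum_congr fun n => ?_
    rw [tsum_fintype]
    simp only [F, Function.comp_apply, sigmaAntidiagonalEquivProd, divisorsAntidiagonalFactors, Equiv.coe_fn_mk,
      PNat.mk_coe]
    rw [Finset.univ_eq_attach, (n : ℕ).divisorsAntidiagonal.sum_attach
      fun x : ℕ × ℕ => χ ((x.2 : ℕ) : ZMod N) * (x.2 : ℂ) ^ s * q ^ (x.1 * x.2 : ℕ),
      twistedSigma, Finset.sum_mul, ← Nat.map_div_left_divisors, Finset.sum_map]
    refine Finset.sum_congr rfl fun d hd => ?_
    change χ ((d : ℕ) : ZMod N) * (d : ℂ) ^ s * q ^ ((n : ℕ) / d * d) = _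
    rw [Nat.div_mul_cancel (Nat.dvd_of_mem_divisors hd)]
  have e1 : lambertCoeff q 0 * χ ((0 : ℕ) : ZMod N) * ((0 : ℕ) : ℂ) ^ s = 0 := by
    simp [lambertCoeff]
  have e2 : twistedSigma s χ 0 * q ^ 0 = 0 := by simp [twistedSigma]
  have s1 : Summable fun m : ℕ => lambertCoeff q m * χ (m : ZMod N) * (m : ℂ) ^ s := by
    have := summable_lambertCoeff hq (δ := 0) (by simpa using hq)
      (u := fun m => χ (m : ZMod N)) (fun m => χ.norm_le_one _) s
    refine Summable.of_norm (this.congr fun m => ?_)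
    simp
  rw [s1.tsum_eq_zero_add, e1, zero_add,
    (summable_norm_twistedSigma s χ hq).of_norm.tsum_eq_zero_add, e2, zero_add,
    ← tsum_pnat_eq_tsum_succ
      (f := fun m : ℕ => lambertCoeff q m * χ (m : ZMod N) * (m : ℂ) ^ s),
    ← tsum_pnat_eq_tsum_succ (f := fun n : ℕ => twistedSigma s χ n * q ^ n), ← h1, ← h2]

theorem apply_zero_eq_zero_of_level_ne_one {N : ℕ} (hN : N ≠ 1) (χ : DirichletCharacter ℂ N) :
    χ 0 = 0 := by
  have : Nontrivial (ZMod N) := by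
    by_contra h
    rw [not_nontrivial_iff_subsingleton, ZMod.subsingleton_iff] at h
    exact hN h
  exact MulChar.map_zero χ

/-- The Taylor coefficients of `twistedGen` are the twisted Eisenstein series of matching parity. -/
theorem iteratedDeriv_twistedGen {N : ℕ} [NeZero N] (χ : DirichletCharacter ℂ N) {q : ℂ}
    (hq : ‖q‖ < 1) {s : ℕ} (hχ : χ (-1) = (-1) ^ (s + 1)) :
    iteratedDeriv s (twistedGen χ q) 0 =
      2 * (twistedEisensteinConst s χ + ∑' n : ℕ, twistedSigma s χ n * q ^ n) := by
  have hB : ∀ x : ℂ, ContDiffAt ℂ s (fun t => bernoulliGenReg x (N * t)) 0 := fun x =>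
    (AnalyticAt.fun_comp (f := fun t : ℂ => (N : ℂ) * t)
      (by simpa using analyticAt_bernoulliGenReg x) (by fun_prop)).contDiffAt
  have hL := (analyticAt_lambertSeries hq (u := fun m => χ (m : ZMod N))
    fun m => χ.norm_le_one _).contDiffAt (n := s)
  have hLneg : ContDiffAt ℂ s
      (fun t => lambertSeries q (fun m => χ (-(m : ZMod N))) (-t)) 0 :=
    (AnalyticAt.fun_comp (f := fun t : ℂ => -t)
      (by
        rw [neg_zero]
        exact analyticAt_lambertSeries hq fun m => χ.norm_le_one _) (by fun_prop)).contDiffAt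
  have hsum : ContDiffAt ℂ s (fun t => ∑ a ∈ Finset.Icc 1 N,
      χ (a : ZMod N) * bernoulliGenReg ((a : ℂ) / N) (N * t)) 0 :=
    ContDiffAt.sum fun a _ => contDiffAt_const.mul (hB _)
  have hdef : twistedGen χ q = fun t => χ 0 / 2 - ∑ a ∈ Finset.Icc 1 N,
      χ (a : ZMod N) * bernoulliGenReg ((a : ℂ) / N) (N * t) +
      lambertSeries q (fun m => χ (m : ZMod N)) t -
      lambertSeries q (fun m => χ (-(m : ZMod N))) (-t) := rfl
  rw [hdef, iteratedDeriv_fun_sub ((contDiffAt_const.sub hsum).add hL) hLneg,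
    iteratedDeriv_fun_add (contDiffAt_const.sub hsum) hL,
    iteratedDeriv_fun_sub contDiffAt_const hsum,
    iteratedDeriv_fun_sum fun a _ => contDiffAt_const.mul (hB _)]
  -- Only s = 0 is in question; there χ(-1) = -1 excludes N = 1, so χ(0) = 0.
  have c1 : iteratedDeriv s (fun _ : ℂ => χ 0 / 2) 0 = 0 := by
    rw [iteratedDeriv_const]
    split_ifs with hs
    · subst hs
      have hN1 : N ≠ 1 := by
        rintro rfl
        have : (-1 : ZMod 1) = 1 := Subsingleton.elim _ _
        rw [this, map_one] at hχ
        norm_num at hχ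
      rw [apply_zero_eq_zero_of_level_ne_one hN1, zero_div]
    · rfl
  -- The chain rule for t ↦ Nt supplies the factor N^s of the generalized Bernoulli number.
  have c2 : ∑ a ∈ Finset.Icc 1 N, iteratedDeriv s
      (fun t => χ (a : ZMod N) * bernoulliGenReg ((a : ℂ) / N) (N * t)) 0 =
      generalizedBernoulli (s + 1) χ / (s + 1) := by
    rw [generalizedBernoulli, Finset.mul_sum, Finset.sum_div]
    refine Finset.sum_congr rfl fun a _ => ?_
    rw [iteratedDeriv_const_mul_field, iteratedDeriv_comp_mul_left_zero (bernoulliGenReg _)]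
    have := iteratedDeriv_bernoulliGenReg ((a : ℚ) / N) s
    push_cast at this
    rw [this]
    push_cast
    rw [add_sub_cancel_right, zpow_natCast]
    ring
  -- Matching parity enters here: (-1)^s χ(-1) = -1, so the two Lambert series reinforce each other
  -- and produce the factor 2.
  have c3 : iteratedDeriv s (fun t => lambertSeries q (fun m => χ (-(m : ZMod N))) (-t)) 0 =
      -iteratedDeriv s (lambertSeries q fun m => χ (m : ZMod N)) 0 := by
    have := iteratedDeriv_comp_mul_left_zero (lambertSeries q (fun m => χ (-(m : ZMod N)))) (-1) s
    simp only [neg_one_mul] at this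
    rw [this, iteratedDeriv_lambertSeries hq fun m => χ.norm_le_one _,
      iteratedDeriv_lambertSeries hq fun m => χ.norm_le_one _, ← tsum_mul_left, ← tsum_neg]
    refine tsum_congr fun m => ?_
    rw [show (-(m : ZMod N)) = -1 * m by ring, map_mul, hχ]
    have : ((-1 : ℂ) ^ s) * (-1) ^ (s + 1) = -1 := by
      rw [← pow_add, Odd.neg_one_pow ⟨s, by ring⟩]
    linear_combination (lambertCoeff q m * χ (m : ZMod N) * (m : ℂ) ^ s) * this
  rw [c1, c2, c3, iteratedDeriv_lambertSeries hq fun m => χ.norm_le_one _,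
    tsum_lambertCoeff_mul s χ hq, twistedEisensteinConst]
  have : (s : ℂ) + 1 ≠ 0 := by exact_mod_cast s.succ_ne_zero
  field_simp
  ring

theorem qParam_one_eq (τ : ℍ) :
    Function.Periodic.qParam 1 (τ : ℂ) = Complex.exp (2 * Real.pi * Complex.I * τ) := by
  simp [Function.Periodic.qParam]

theorem norm_qParam_one_lt_one (τ : ℍ) : ‖Function.Periodic.qParam 1 (τ : ℂ)‖ < 1 := by
  rw [qParam_one_eq]
  exact norm_exp_two_pi_I_mul_lt_one τ.im_pos

/-- The transformation law of the twisted Eisenstein series under `Γ₀(N)`. -/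
theorem twistedEisenstein_smul {N : ℕ} [NeZero N] (χ : DirichletCharacter ℂ N) {s : ℕ}
    (hχ : χ (-1) = (-1) ^ (s + 1)) (hs : ¬ (s = 1 ∧ N = 1)) {γ : SL(2, ℤ)}
    (hγ : γ ∈ CongruenceSubgroup.Gamma0 N) (τ : ℍ) :
    twistedEisenstein s χ (γ • τ) = χ ((γ 1 1 : ℤ) : ZMod N) *
      (((γ 1 0 : ℤ) : ℂ) * (τ : ℂ) + ((γ 1 1 : ℤ) : ℂ)) ^ ((s : ℤ) + 1) *
        twistedEisenstein s χ τ := by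
  have hdet : γ 0 0 * γ 1 1 - γ 0 1 * γ 1 0 = 1 := by
    rw [← Matrix.det_fin_two]; exact γ.2
  have hc : (N : ℤ) ∣ γ 1 0 := by
    rw [CongruenceSubgroup.Gamma0_mem] at hγ
    exact (ZMod.intCast_zmod_eq_zero_iff_dvd _ _).mp hγ
  have hj : ((γ 1 0 : ℤ) : ℂ) * (τ : ℂ) + ((γ 1 1 : ℤ) : ℂ) ≠ 0 := by
    have := UpperHalfPlane.denom_ne_zero (γ : GL (Fin 2) ℝ) τ
    simpa [UpperHalfPlane.denom] using this
  have hsmul : ((γ • τ : ℍ) : ℂ) * (((γ 1 0 : ℤ) : ℂ) * (τ : ℂ) + ((γ 1 1 : ℤ) : ℂ)) =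
      ((γ 0 0 : ℤ) : ℂ) * τ + ((γ 0 1 : ℤ) : ℂ) := by
    rw [UpperHalfPlane.specialLinearGroup_apply]
    simp only [algebraMap_int_eq, eq_intCast, Complex.ofReal_intCast]
    rw [div_mul_cancel₀ _ hj]
  have key := (twistedGen_div χ τ.im_pos (γ • τ).im_pos hdet hc hj hsmul).iteratedDeriv_eq s
  set j : ℂ := ((γ 1 0 : ℤ) : ℂ) * (τ : ℂ) + ((γ 1 1 : ℤ) : ℂ) with hjdef
  have hq := norm_exp_two_pi_I_mul_lt_one τ.im_pos
  have hq' := norm_exp_two_pi_I_mul_lt_one (γ • τ).im_pos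
  -- The anomaly is linear in t, so it affects only s = 1, and it carries χ(0), which vanishes
  -- unless N = 1: exactly the excluded quasimodular case.
  have hlin : iteratedDeriv s (fun t : ℂ => ((γ 1 0 : ℤ) : ℂ) * χ 0 / (2 * Real.pi * Complex.I) * t) 0
      = 0 := by
    rw [iteratedDeriv_const_mul_field, iteratedDeriv_fun_id_zero]
    split_ifs with h1
    · rw [apply_zero_eq_zero_of_level_ne_one fun h => hs ⟨h1, h⟩]
      simp
    · simp
  rw [iteratedDeriv_comp_mul_left_zero (twistedGen χ _), iteratedDeriv_fun_sub
    (contDiffAt_const.mul (analyticAt_twistedGen χ hq).contDiffAt) (by fun_prop), hlin, sub_zero,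
    iteratedDeriv_const_mul_field, iteratedDeriv_twistedGen χ hq hχ,
    iteratedDeriv_twistedGen χ hq' hχ] at key
  rw [twistedEisenstein, twistedEisenstein, qParam_one_eq, qParam_one_eq]
  rw [inv_pow, inv_mul_eq_iff_eq_mul₀ (pow_ne_zero _ hj)] at key
  have hz : j ^ ((s : ℤ) + 1) = j ^ s * j := by
    rw [zpow_add_one₀ hj, zpow_natCast]
  rw [hz]
  linear_combination key / 2

/-! ### Holomorphy, growth and the cusps. -/

open scoped Topology Manifold ModularForm

theorem abs_re_invQParam_le {h : ℝ} (hh : 0 < h) (q : ℂ) :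
    |(Function.Periodic.invQParam h q).re| ≤ h := by
  have e : (Function.Periodic.invQParam h q).re = h / (2 * Real.pi) * q.arg := by
    rw [Function.Periodic.invQParam, show (h : ℂ) / (2 * Real.pi * Complex.I) * Complex.log q =
      ((h / (2 * Real.pi) : ℝ) : ℂ) * (-Complex.I * Complex.log q) by
        push_cast; rw [mul_comm _ Complex.I, ← div_div, div_eq_mul_inv _ (2 * (Real.pi : ℂ)),
          div_eq_mul_inv (h : ℂ) Complex.I, Complex.inv_I]; ring, Complex.re_ofReal_mul]
    simp [Complex.log_im]
  rw [e, abs_mul, abs_of_pos (by positivity)]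
  calc h / (2 * Real.pi) * |q.arg| ≤ h / (2 * Real.pi) * Real.pi := by
        gcongr; exact Complex.abs_arg_le_pi q
    _ = h / 2 := by field_simp
    _ ≤ h := by linarith

/-- A periodic holomorphic function of at most polynomial growth on a vertical strip is bounded at
infinity. -/
theorem isBoundedAtImInfty_of_periodic_of_le_pow {f : ℍ → ℂ} {h : ℝ} (hh : 0 < h)
    (hper : Function.Periodic (f ∘ UpperHalfPlane.ofComplex) h) (hhol : MDiff f) {C : ℝ} {M : ℕ}
    (hb : ∀ τ : ℍ, |τ.re| ≤ h → 1 ≤ τ.im → ‖f τ‖ ≤ C * τ.im ^ M) :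
    UpperHalfPlane.IsBoundedAtImInfty f := by
  set F := Function.Periodic.cuspFunction h (f ∘ UpperHalfPlane.ofComplex) with hF
  have him : Filter.Tendsto (fun q => (Function.Periodic.invQParam h q).im) (𝓝[≠] 0)
      Filter.atTop := Filter.tendsto_comap_iff.mp (Function.Periodic.invQParam_tendsto hh)
  have hd : ∀ᶠ z in 𝓝[≠] 0, DifferentiableAt ℂ F z :=
    Function.Periodic.eventually_differentiableAt_cuspFunction_nhds_ne_zero hh hper
      (Filter.eventually_of_mem (Filter.preimage_mem_comap (Filter.Ioi_mem_atTop 0))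
        fun z hz => UpperHalfPlane.mdifferentiableAt_iff.mp (hhol ⟨z, hz⟩))
  have hlim : Filter.Tendsto (fun y : ℝ => C * (y ^ M * Real.exp (-(2 * Real.pi / h) * y)))
      Filter.atTop (𝓝 0) := by
    have := tendsto_rpow_mul_exp_neg_mul_atTop_nhds_zero M (2 * Real.pi / h) (by positivity)
    simpa using this.const_mul C
  -- Here |F(q)| ≤ C y^M while |q| = exp(-2πy/h), so F(q) = o(1/q) and the singularity at q = 0 is
  -- removable.
  have hzero : Filter.Tendsto (fun q => F q * q) (𝓝[≠] 0) (𝓝 0) := by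
    refine squeeze_zero_norm' ?_ (hlim.comp him)
    filter_upwards [him.eventually_ge_atTop 1, self_mem_nhdsWithin] with q hq1 hq0
    have hpos : 0 < (Function.Periodic.invQParam h q).im := zero_lt_one.trans_le hq1
    have hnorm : ‖q‖ = Real.exp (-(2 * Real.pi / h) * (Function.Periodic.invQParam h q).im) := by
      conv_lhs => rw [← Function.Periodic.qParam_right_inv hh.ne' hq0,
        Function.Periodic.norm_qParam]
      congr 1
      ring
    rw [norm_mul, hF, Function.Periodic.cuspFunction_eq_of_nonzero _ _ hq0, Function.comp_apply,
      UpperHalfPlane.ofComplex_apply_of_im_pos hpos, Function.comp_apply, ← mul_assoc]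
    refine mul_le_mul (hb ⟨_, hpos⟩ (abs_re_invQParam_le hh q) hq1) hnorm.le (norm_nonneg _) ?_
    exact (norm_nonneg _).trans (hb ⟨_, hpos⟩ (abs_re_invQParam_le hh q) hq1)
  have ho : (fun z => F z - F 0) =o[𝓝[≠] 0] fun z => (z - 0)⁻¹ := by
    rw [Asymptotics.isLittleO_iff_tendsto']
    · have h2 : Filter.Tendsto (fun q : ℂ => F 0 * q) (𝓝[≠] 0) (𝓝 0) := by
        have : Filter.Tendsto (fun q : ℂ => F 0 * q) (𝓝 0) (𝓝 (F 0 * 0)) :=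
          (continuous_const.mul continuous_id).tendsto 0
        rw [mul_zero] at this
        exact this.mono_left nhdsWithin_le_nhds
      have := hzero.sub h2
      simp only [sub_zero, div_inv_eq_mul, sub_mul] at this ⊢
      exact this
    · filter_upwards [self_mem_nhdsWithin] with q hq h0
      rw [sub_zero, inv_eq_zero] at h0
      exact absurd h0 hq
  have hF0 :=
    Complex.tendsto_limUnder_of_differentiable_on_punctured_nhds_of_isLittleO hd ho
  have key := hF0.comp ((Function.Periodic.qParam_tendsto hh).comp
    UpperHalfPlane.tendsto_coe_atImInfty)
  refine Filter.Tendsto.isBigO_one ℝ (key.congr fun τ => ?_) |>.trans ?_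
  · exact UpperHalfPlane.eq_cuspFunction τ hh.ne' hper
  · exact Asymptotics.isBigO_of_le _ (by simp)

theorem summable_pow_mul_exp_neg (k : ℕ) {y : ℝ} (hy : 0 < y) :
    Summable fun n : ℕ => (n : ℝ) ^ k * Real.exp (n * (-y)) := by
  refine (Real.summable_pow_mul_exp_neg_nat_mul k hy).congr fun n => ?_
  rw [mul_neg, neg_mul, mul_comm y]

/-- The twisted Eisenstein series are holomorphic on the upper half-plane. -/
theorem mdifferentiable_twistedEisenstein (s : ℕ) {N : ℕ} (χ : DirichletCharacter ℂ N) :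
    MDiff (twistedEisenstein s χ) := by
  rw [UpperHalfPlane.mdifferentiable_iff]
  intro z hz
  have hz' : 0 < z.im := hz
  have hsum : ∀ j : ℕ, Summable fun m : ℕ =>
      ‖twistedSigma s χ m‖ * (m : ℝ) ^ j * Real.exp (m * (-(Real.pi * z.im))) := by
    intro j
    refine Summable.of_nonneg_of_le (fun m => by positivity) (fun m => ?_)
      (summable_pow_mul_exp_neg (s + 1 + j) (mul_pos Real.pi_pos hz'))
    rw [pow_add]
    gcongr
    exact norm_twistedSigma_le s χ m
  have hre : (2 * Real.pi * Complex.I * z).re = -(2 * Real.pi * z.im) := by simp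
  have hd : DifferentiableAt ℂ (fun t : ℂ => ∑' m : ℕ, twistedSigma s χ m * Complex.exp (m * t))
      (2 * Real.pi * Complex.I * z) := by
    refine (differentiableOn_expSeries hsum).differentiableAt
      ((isOpen_lt Complex.continuous_re continuous_const).mem_nhds ?_)
    rw [Set.mem_ofPred_eq, hre]
    nlinarith [mul_pos Real.pi_pos hz']
  have hd' : DifferentiableAt ℂ (fun w : ℂ => twistedEisensteinConst s χ +
      ∑' m : ℕ, twistedSigma s χ m * Complex.exp (m * (2 * Real.pi * Complex.I * w))) z :=
    (hd.comp z (f := fun w : ℂ => 2 * Real.pi * Complex.I * w) (by fun_prop)).const_add _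
  refine (hd'.congr_of_eventuallyEq ?_).differentiableWithinAt
  filter_upwards [UpperHalfPlane.isOpen_upperHalfPlaneSet.mem_nhds hz] with w hw
  rw [Function.comp_apply, UpperHalfPlane.ofComplex_apply_of_im_pos hw, twistedEisenstein,
    qParam_one_eq]
  simp only [← Complex.exp_nat_mul]

/-- The twisted Eisenstein series have moderate growth near the real axis. -/
theorem exists_norm_twistedEisenstein_le (s : ℕ) {N : ℕ} (χ : DirichletCharacter ℂ N) :
    ∃ C : ℝ, 0 ≤ C ∧ ∀ τ : ℍ, ‖twistedEisenstein s χ τ‖ ≤ C * (1 + (τ.im⁻¹) ^ (s + 3)) := by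
  set Z : ℝ := ∑' n : ℕ, 1 / (n : ℝ) ^ 2
  have hZs : Summable fun n : ℕ => 1 / (n : ℝ) ^ 2 :=
    Real.summable_one_div_nat_pow.mpr one_lt_two
  have hZ : 0 ≤ Z := tsum_nonneg fun n => by positivity
  refine ⟨‖twistedEisensteinConst s χ‖ + (s + 3).factorial * Z, by positivity, fun τ => ?_⟩
  have hy := τ.im_pos
  have hterm : ∀ n : ℕ, ‖twistedSigma s χ n * Function.Periodic.qParam 1 (τ : ℂ) ^ n‖ ≤
      (s + 3).factorial * (τ.im⁻¹) ^ (s + 3) * (1 / (n : ℝ) ^ 2) := by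
    intro n
    rcases n.eq_zero_or_pos with rfl | hn
    · simp [twistedSigma]
    have hn' : (0 : ℝ) < n := Nat.cast_pos.mpr hn
    have hexp : ‖Function.Periodic.qParam 1 (τ : ℂ)‖ ^ n ≤ (Real.exp (n * τ.im))⁻¹ := by
      rw [Function.Periodic.norm_qParam, ← Real.exp_nat_mul, ← Real.exp_neg]
      refine Real.exp_le_exp.mpr ?_
      rw [UpperHalfPlane.coe_im]
      nlinarith [mul_pos hn' hy, Real.pi_gt_three, mul_pos (mul_pos hn' hy) Real.pi_pos]
    -- The exponent s + 3 exceeds that of the bound n^(s+1) by two, which leaves the summable 1/n².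
    have hpow := Real.pow_div_factorial_le_exp (n * τ.im) (by positivity) (s + 3)
    rw [norm_mul, norm_pow]
    calc _ ≤ (n : ℝ) ^ (s + 1) * (Real.exp (n * τ.im))⁻¹ :=
          mul_le_mul (norm_twistedSigma_le s χ n) hexp (by positivity) (by positivity)
      _ ≤ (n : ℝ) ^ (s + 1) * ((n * τ.im) ^ (s + 3) / (s + 3).factorial)⁻¹ := by gcongr
      _ = _ := by
          rw [mul_pow, inv_div, inv_pow]
          field_simp
          ring
  have hsum := hZs.mul_left ((s + 3).factorial * (τ.im⁻¹) ^ (s + 3))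
  rw [twistedEisenstein]
  refine (norm_add_le _ _).trans ?_
  have h1 := tsum_of_norm_bounded hsum.hasSum hterm
  rw [tsum_mul_left] at h1
  have h2 : 0 ≤ (τ.im⁻¹) ^ (s + 3) := by positivity
  calc _ ≤ ‖twistedEisensteinConst s χ‖ + (s + 3).factorial * (τ.im⁻¹) ^ (s + 3) * Z := by gcongr
    _ ≤ _ := by
      nlinarith [mul_nonneg (norm_nonneg (twistedEisensteinConst s χ)) h2,
        mul_nonneg (Nat.cast_nonneg (α := ℝ) (s + 3).factorial) hZ]

/-- The translates of the twisted Eisenstein series grow at most polynomially on strips. -/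
theorem exists_norm_twistedEisenstein_slash_le (s : ℕ) {N : ℕ} (χ : DirichletCharacter ℂ N)
    (γ : SL(2, ℤ)) {h : ℝ} (hh : 0 < h) :
    ∃ (C : ℝ) (M : ℕ), ∀ τ : ℍ, |τ.re| ≤ h → 1 ≤ τ.im →
      ‖(twistedEisenstein s χ ∣[(s : ℤ) + 1] γ) τ‖ ≤ C * τ.im ^ M := by
  obtain ⟨C, hC, hE⟩ := exists_norm_twistedEisenstein_le s χ
  set K : ℝ := |((γ 1 0 : ℤ) : ℝ)| * (h + 1) + |((γ 1 1 : ℤ) : ℝ)|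
  have hK : 0 ≤ K := by positivity
  refine ⟨C * (1 + (K ^ 2) ^ (s + 3)), s + 3, fun τ hre him => ?_⟩
  have hy := τ.im_pos
  set j := UpperHalfPlane.denom (γ : GL (Fin 2) ℝ) τ with hj
  have hj' : j = ((γ 1 0 : ℤ) : ℂ) * (τ : ℂ) + ((γ 1 1 : ℤ) : ℂ) := by
    simp [hj, UpperHalfPlane.denom]
  -- Since the weight is positive, this makes the automorphy factor harmless.
  have hlow : 1 ≤ ‖j‖ := by
    by_cases hc : γ 1 0 = 0
    · have hd : γ 1 1 ≠ 0 := fun hd => by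
        have := γ.2
        rw [Matrix.det_fin_two] at this
        simp [hc, hd] at this
      rw [hj', hc]
      simp only [Int.cast_zero, zero_mul, zero_add, Complex.norm_intCast]
      exact_mod_cast Int.one_le_abs hd
    · refine le_trans ?_ (Complex.abs_im_le_norm j)
      have him' : j.im = (γ 1 0 : ℤ) * τ.im := by simp [hj']
      rw [him', abs_mul, abs_of_pos hy]
      have : (1 : ℝ) ≤ |((γ 1 0 : ℤ) : ℝ)| := by exact_mod_cast Int.one_le_abs hc
      nlinarith
  have hup : ‖j‖ ≤ K * τ.im := by
    have hτ : ‖(τ : ℂ)‖ ≤ (h + 1) * τ.im := by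
      refine (Complex.norm_le_abs_re_add_abs_im _).trans ?_
      rw [UpperHalfPlane.coe_re, UpperHalfPlane.coe_im, abs_of_pos hy]
      nlinarith
    rw [hj']
    refine (norm_add_le _ _).trans ?_
    rw [norm_mul, Complex.norm_intCast, Complex.norm_intCast]
    have h1 := mul_le_mul_of_nonneg_left hτ (abs_nonneg ((γ 1 0 : ℤ) : ℝ))
    have h2 := mul_le_mul_of_nonneg_left him (abs_nonneg ((γ 1 1 : ℤ) : ℝ))
    simp only [K]
    linarith
  -- Moderate growth near the real axis thus becomes polynomial growth in Im τ after translation by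
  -- γ.
  have himγ : (γ • τ).im⁻¹ ≤ K ^ 2 * τ.im := by
    have e : (γ • τ).im = τ.im / Complex.normSq j :=
      ModularGroup.im_smul_eq_div_normSq γ τ
    rw [e, inv_div, Complex.normSq_eq_norm_sq, div_le_iff₀ hy]
    calc ‖j‖ ^ 2 ≤ (K * τ.im) ^ 2 := by gcongr
      _ = _ := by ring
  rw [ModularForm.SL_slash_apply, norm_mul, norm_zpow, zpow_neg]
  have hinv : (‖j‖ ^ ((s : ℤ) + 1))⁻¹ ≤ 1 :=
    inv_le_one_of_one_le₀ (one_le_zpow₀ hlow (by positivity))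
  have h1 : 0 ≤ (γ • τ).im⁻¹ := (inv_pos.mpr (γ • τ).im_pos).le
  calc _ ≤ C * (1 + ((γ • τ).im⁻¹) ^ (s + 3)) * 1 :=
        mul_le_mul (hE _) hinv (by positivity) (by positivity)
    _ ≤ C * (1 * τ.im ^ (s + 3) + (K ^ 2 * τ.im) ^ (s + 3)) := by
        rw [mul_one, one_mul]
        gcongr
        exact one_le_pow₀ him
    _ = _ := by rw [mul_pow]; ring

/-- The twisted Eisenstein series are invariant under `Γ₁(N)`. -/
theorem twistedEisenstein_slash_eq {s N : ℕ} [NeZero N] (χ : DirichletCharacter ℂ N)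
    (hχ : χ (-1) = (-1) ^ (s + 1)) (hs : ¬(s = 1 ∧ N = 1)) {γ : SL(2, ℤ)}
    (hγ : γ ∈ CongruenceSubgroup.Gamma1 N) :
    twistedEisenstein s χ ∣[(s : ℤ) + 1] γ = twistedEisenstein s χ := by
  funext τ
  rw [ModularForm.slash_action_eq'_iff, twistedEisenstein_smul χ hχ hs
    (CongruenceSubgroup.Gamma1_in_Gamma0 N hγ), ((CongruenceSubgroup.Gamma1_mem N γ).mp hγ).2.1,
    map_one, one_mul]

theorem isBoundedAtImInfty_twistedEisenstein_slash {s N : ℕ} [NeZero N]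
    (χ : DirichletCharacter ℂ N) (hχ : χ (-1) = (-1) ^ (s + 1)) (hs : ¬(s = 1 ∧ N = 1))
    (γ : SL(2, ℤ)) :
    UpperHalfPlane.IsBoundedAtImInfty (twistedEisenstein s χ ∣[(s : ℤ) + 1] γ) := by
  have hN : (0 : ℝ) < N := Nat.cast_pos.mpr (NeZero.pos N)
  obtain ⟨C, M, hb⟩ := exists_norm_twistedEisenstein_slash_le s χ γ hN
  refine isBoundedAtImInfty_of_periodic_of_le_pow hN ?_
    ((mdifferentiable_twistedEisenstein s χ).slash _ γ) hb
  set f := twistedEisenstein s χ ∣[(s : ℤ) + 1] γ with hf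
  have hT : ModularGroup.T ^ (N : ℤ) ∈ CongruenceSubgroup.Gamma N :=
    CongruenceSubgroup.ModularGroup_T_pow_mem_Gamma N N dvd_rfl
  -- Γ(N) is normal and contained in Γ₁(N), so every translate of the form has period N.
  have hconj : γ * ModularGroup.T ^ (N : ℤ) * γ⁻¹ ∈ CongruenceSubgroup.Gamma1 N := by
    have := (CongruenceSubgroup.Gamma_normal N).conj_mem _ hT γ
    rw [CongruenceSubgroup.Gamma_mem] at this
    exact (CongruenceSubgroup.Gamma1_mem N _).mpr ⟨this.1, this.2.2.2, this.2.2.1⟩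
  have hinv : f ∣[(s : ℤ) + 1] (ModularGroup.T ^ (N : ℤ)) = f := by
    rw [hf, ← SlashAction.slash_mul,
      show γ * ModularGroup.T ^ (N : ℤ) = γ * ModularGroup.T ^ (N : ℤ) * γ⁻¹ * γ by group,
      SlashAction.slash_mul, twistedEisenstein_slash_eq χ hχ hs hconj]
  have hstep : ∀ τ : ℍ, f ((N : ℝ) +ᵥ τ) = f τ := by
    intro τ
    have := (ModularForm.slash_action_eq'_iff _ _ _ _).mp (congrFun hinv τ)
    rw [UpperHalfPlane.modular_T_zpow_smul] at this
    rw [ModularGroup.coe_T_zpow] at this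
    simpa using this
  intro w
  by_cases hw : 0 < w.im
  · have hw' : 0 < (w + (N : ℝ)).im := by simpa using hw
    rw [Function.comp_apply, Function.comp_apply, UpperHalfPlane.ofComplex_apply_of_im_pos hw,
      UpperHalfPlane.ofComplex_apply_of_im_pos hw', ← hstep ⟨w, hw⟩]
    congr 1
    ext
    simp [add_comm]
  · have hw' : ¬ 0 < (w + (N : ℝ)).im := by simpa using hw
    rw [Function.comp_apply, Function.comp_apply,
      UpperHalfPlane.ofComplex_apply_of_im_nonpos (not_lt.mp hw),
      UpperHalfPlane.ofComplex_apply_of_im_nonpos (not_lt.mp hw')]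

/-- The twisted Eisenstein series of matching parity are modular forms with Nebentypus. -/
theorem isModularFormNebentypus_twistedEisenstein {s N : ℕ} [NeZero N]
    (χ : DirichletCharacter ℂ N) (hχ : χ (-1) = (-1) ^ (s + 1)) (hs : ¬(s = 1 ∧ N = 1)) :
    IsModularFormNebentypus N ((s : ℤ) + 1) χ (twistedEisenstein s χ) := by
  refine ⟨⟨{
    toFun := twistedEisenstein s χ
    slash_action_eq' := ?_
    holo' := mdifferentiable_twistedEisenstein s χ
    bdd_at_cusps' := fun {c} hc => ?_ }, rfl⟩, fun γ hγ τ => twistedEisenstein_smul χ hχ hs hγ τ⟩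
  · rintro _ ⟨γ, hγ, rfl⟩
    exact twistedEisenstein_slash_eq χ hχ hs hγ
  -- The cusps are those of SL(2, ℤ), so boundedness at infinity of all SL(2, ℤ)-translates
  -- suffices.
  · rw [Subgroup.IsArithmetic.isCusp_iff_isCusp_SL2Z] at hc
    rw [OnePoint.isBoundedAt_iff_forall_SL2Z hc]
    exact fun γ _ => isBoundedAtImInfty_twistedEisenstein_slash χ hχ hs γ

/-! ### Assembly of the three claims. -/

theorem GlaisherFilter.divisorSum_eq_sum_twistedSigma (F : GlaisherFilter)
    {c : (Σ N : ℕ, DirichletCharacter ℂ N) →₀ ℂ}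
    (hc : ∀ d : ℕ, (open Classical in if F.Holds d then (1 : ℂ) else 0) =
      c.sum fun x a => a * x.2 (d : ZMod x.1)) (s n : ℕ) :
    (F.divisorSum s n : ℂ) = ∑ x ∈ c.support, c x * twistedSigma s x.2 n := by
  classical
  rw [GlaisherFilter.divisorSum, Finset.sum_filter]
  push_cast
  simp only [twistedSigma, Finset.mul_sum]
  rw [Finset.sum_comm]
  refine Finset.sum_congr rfl fun d _ => ?_
  have h := hc d
  rw [Finsupp.sum] at h
  calc _ = (if F.Holds d then (1 : ℂ) else 0) * (d : ℂ) ^ s := by split_ifs <;> simp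
    _ = (∑ x ∈ c.support, c x * x.2 (d : ZMod x.1)) * (d : ℂ) ^ s := by rw [← h]
    _ = _ := by rw [Finset.sum_mul]; simp only [mul_assoc]

theorem ModularForm.eta_eq_qParam_mul_tprod (z : ℂ) :
    ModularForm.eta z = Function.Periodic.qParam 24 z *
      ∏' i : ℕ, (1 - Function.Periodic.qParam 1 z ^ (i + 1)) := by
  rw [ModularForm.eta]

theorem mainTheorem4 (F : GlaisherFilter) :
    ∃ (T : Finset (Σ N : ℕ, DirichletCharacter ℂ N))
      (c : (Σ N : ℕ, DirichletCharacter ℂ N) → ℂ),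
      (∀ x ∈ T, x.1 ∣ F.level ∧
        c x ∈ IntermediateField.adjoin ℚ (Set.range fun a : ZMod x.1 => x.2 a)) ∧
      ∀ s : ℕ,
        (∀ n : ℕ, (F.divisorSum s n : ℂ) = ∑ x ∈ T, c x * twistedSigma s x.2 n) ∧
        (∀ τ : ℍ,
          Summable (fun n : ℕ =>
            (F.divisorSum s n : ℂ) * Function.Periodic.qParam 1 (τ : ℂ) ^ n) ∧
          Summable (fun n : ℕ =>
            (F.frequencyMoment s n : ℂ) * Function.Periodic.qParam 1 (τ : ℂ) ^ n) ∧
          (Function.Periodic.qParam 24 (τ : ℂ))⁻¹ *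
              ∑' n : ℕ, (F.frequencyMoment s n : ℂ) * Function.Periodic.qParam 1 (τ : ℂ) ^ n =
            (ModularForm.eta (τ : ℂ))⁻¹ *
              ∑' n : ℕ, (F.divisorSum s n : ℂ) * Function.Periodic.qParam 1 (τ : ℂ) ^ n ∧
          (Function.Periodic.qParam 24 (τ : ℂ))⁻¹ *
              ∑' n : ℕ, (F.frequencyMoment s n : ℂ) * Function.Periodic.qParam 1 (τ : ℂ) ^ n =
            (ModularForm.eta (τ : ℂ))⁻¹ *
              ∑ x ∈ T, c x * (twistedEisenstein s x.2 τ - twistedEisensteinConst s x.2)) ∧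
        ∀ x ∈ T, x.2 (-1) = (-1) ^ (s + 1) → ¬ (s = 1 ∧ x.1 = 1) →
          IsModularFormNebentypus x.1 ((s : ℤ) + 1) x.2 (twistedEisenstein s x.2) := by
  obtain ⟨c, hcfield, hclevel, hc⟩ := F.exists_characterCombination
  refine ⟨c.support, c, fun x hx => ⟨hclevel x (Finsupp.mem_support_iff.mp hx), hcfield x⟩,
    fun s => ?_⟩
  have hdiv := F.divisorSum_eq_sum_twistedSigma hc s
  refine ⟨hdiv, fun τ => ?_, fun x hx hχ hs => ?_⟩
  · have hq := norm_qParam_one_lt_one τ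
    have hsum := F.hasSum_frequencyMoment s hq
    -- `qParam 24` is q^(1/24), the prefactor of η; what remains of η⁻¹ is Euler's product.
    have hmain : (Function.Periodic.qParam 24 (τ : ℂ))⁻¹ *
        ∑' n : ℕ, (F.frequencyMoment s n : ℂ) * Function.Periodic.qParam 1 (τ : ℂ) ^ n =
        (ModularForm.eta (τ : ℂ))⁻¹ *
          ∑' n : ℕ, (F.divisorSum s n : ℂ) * Function.Periodic.qParam 1 (τ : ℂ) ^ n := by
      rw [hsum.tsum_eq, ModularForm.eta_eq_qParam_mul_tprod, mul_inv]
      ring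
    refine ⟨(F.summable_norm_divisorSum s hq).of_norm, hsum.summable, hmain, hmain.trans ?_⟩
    congr 1
    simp only [hdiv, twistedEisenstein, add_sub_cancel_left, Finset.sum_mul, mul_assoc]
    rw [Summable.tsum_finsetSum fun x _ =>
      (summable_norm_twistedSigma s x.2 hq).of_norm.mul_left (c x)]
    simp only [tsum_mul_left]
  · have : NeZero x.1 := ⟨(Nat.pos_of_dvd_of_pos (hclevel x (Finsupp.mem_support_iff.mp hx))
      F.level_pos).ne'⟩
    exact isModularFormNebentypus_twistedEisenstein x.2 hχ hs
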